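/- Let $(M,d)$ be a global NPC (CAT(0), Hadamard) space, i.e. a complete metric space such that for all $x,y\in M$ there is $m\in M$ with $d^2(z,m)\le\frac12d^2(z,x)+\frac12d^2(z,y)-\frac14d^2(x,y)$ for all $z\in M$. Write $x\#_ty=\gamma_{x,y}(t)$, $t\in[0,1]$, where $\gamma_{x,y}:[0,1]\to M$ is the unique minimal geodesic from $x$ to $y$. Let $1\le p<\infty$. Let $\mathcal P^p(M)$ be the set of Borel probability measures $\mu$ on $M$ that are carried by their support and satisfy $\int_M d^p(x,y)\,d\mu(y)<\infty$ for some $x\in M$, and let $d_p^W$ be the $p$-Wasserstein distance on $\mathcal P^p(M)$, $d_p^W(\mu,\nu)=\bigl[\inf_\pi\int_{M\times M}d^p(x,y)\,d\pi(x,y)\bigr]^{1/p}$, with the infimum over all couplings $\pi$ of $\mu$ and $\nu$ (Borel probability measures on $M\times M$ carried by their support, with marginals $\mu,\nu$). Let $\mathcal C_p(M)$ be the set of $p$-contractive barycentric maps, i.e. maps $\beta:\mathcal P^p(M)\to M$ with $\beta(\delta_x)=x$ for all $x\in M$ and $d(\beta(\mu),\beta(\nu))\le d_p^W(\mu,\nu)$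 for all $\mu,\nu\in\mathcal P^p(M)$, equipped with the distance $$d_p(\beta_1,\beta_2)=\sup\Bigl\{\frac{d(\beta_1(\mathbf x),\beta_2(\mathbf x))}{\Delta(\mathbf x)}:\ n\ge1,\ \mathbf x=(x_1,\dots,x_n)\in M^n,\ \Delta(\mathbf x)\ne0\Bigr\},$$ where $\beta(\mathbf x)=\beta\bigl(\frac1n\sum_{j=1}^n\delta_{x_j}\bigr)$ and $\Delta(\mathbf x)$ is the diameter of $\{x_1,\dots,x_n\}$. For $x\in M$, $t\in[0,1]$ and $\mu\in\mathcal P^p(M)$ let $x\#_t\mu$ be the push-forward of $\mu$ by $a\mapsto x\#_ta$. Let $k_2=2$ and, for $q>2$, $k_q=\frac{8}{2^q}\,\frac{1+\tau_q^{q-1}}{(1+\tau_q)^{q-1}}$, where $\tau_q$ is the unique solution in $(1,\infty)$ of $x^{q-1}+(1-q)x+2-q=0$. Theorem. One has $x\#_t\mu\in\mathcal P^p(M)$ for all $x\in M$, $t\in[0,1]$, $\mu\in\mathcal P^p(M)$, and there is a map $\Phi_p:(0,1]\times\mathcal C_p(M)\to\mathcal C_p(M)$ which is a continuous semiflow for the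 multiplicative semigroup $(0,1]$ (that is, $\Phi_p$ is jointly continuous, $\Phi_p(1,\beta)=\beta$, and $\Phi_p(t,\Phi_p(s,\beta))=\Phi_p(ts,\beta)$) and which satisfies $$x=\Phi_p(t,\beta)(\mu)\iff x=\beta(x\#_t\mu)$$ for all $t\in(0,1]$, $\beta\in\mathcal C_p(M)$, $\mu\in\mathcal P^p(M)$ and $x\in M$. Furthermore, for all $s,t\in(0,1]$ and $\beta\in\mathcal C_p(M)$, $$d_p\bigl(\Phi_p(t,\beta),\Phi_p(s,\beta)\bigr)\le\left[\frac{k_{2p}(s+t)+2(2-k_{2p})}{4}\right]^{\frac1{2p}}.$$ If $p=1$, then for every $\beta\in\mathcal C_1(M)$ one has $\lim_{t\to0^+}\Phi_1(t,\beta)=\lambda$ with respect to $d_1$, where $\lambda\in\mathcal C_1(M)$ is the canonical barycentric map: for every $\mu\in\mathcal P^1(M)$ and every $y\in M$, $\lambda(\mu)$ is the unique minimizer of $z\mapsto\int_M[d^2(z,x)-d^2(y,x)]\,d\mu(x)$ over $z\in M$. -/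

import Mathlib

open MeasureTheory Set Filter Topology
open scoped ENNReal

noncomputable section

/-! ### Global NPC spaces and their geodesics -/

/-- A global NPC space (also called a CAT(0) or Hadamard space): a complete metric space in which
every two points `x, y` admit a point `m` satisfying the Bruhat-Tits (CN) inequality. -/
structure IsGlobalNPC (M : Type*) [MetricSpace M] : Prop where
  complete : CompleteSpace M
  exists_midpoint : ∀ x y : M, ∃ m : M, ∀ z : M,
    dist z m ^ 2 ≤ (1 / 2) * dist z x ^ 2 + (1 / 2) * dist z y ^ 2 - (1 / 4) * dist x y ^ 2

/-- `γ`, restricted to `[0,1]`, is a minimal geodesic from `x` to `y`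
(parametrized proportionally to arc length). -/
def IsMinimalGeodesic {M : Type*} [MetricSpace M] (γ : ℝ → M) (x y : M) : Prop :=
  γ 0 = x ∧ γ 1 = y ∧
    ∀ s ∈ Icc (0 : ℝ) 1, ∀ t ∈ Icc (0 : ℝ) 1, dist (γ s) (γ t) = |s - t| * dist x y

open Classical in
/-- The point `x #_t y = γ(t)` (`0 ≤ t ≤ 1`) of the minimal geodesic `γ` from `x` to `y`.
In a global NPC space the minimal geodesic exists and is unique on `[0,1]`; the `else` branch is
never used there. -/
def geodPoint {M : Type*} [MetricSpace M] (x : M) (t : ℝ) (y : M) : M :=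
  if h : ∃ γ : ℝ → M, IsMinimalGeodesic γ x y then h.choose t else x

/-- The measure `x #_t μ`, the push-forward of `μ` by `a ↦ x #_t a`. -/
def geodMeasure {M : Type*} [MetricSpace M] [MeasurableSpace M] (x : M) (t : ℝ)
    (μ : Measure M) : Measure M :=
  μ.map (fun a => geodPoint x t a)

/-! ### Probability measures with finite `p`-th moment, Wasserstein distance -/

/-- `μ` is carried by its topological support. (This is automatic on separable metric spaces;
on a metric space it means that `μ` has separable support of full measure.) -/
def HasFullSupport {X : Type*} [TopologicalSpace X] [MeasurableSpace X] (μ : Measure X) : Prop :=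
  μ (μ.support)ᶜ = 0

/-- `μ` is a Borel probability measure carried by its support and
`∫ d(x,y)^p dμ(y) < ∞` for some `x`. -/
structure IsProbPMoment {M : Type*} [MetricSpace M] [MeasurableSpace M] (p : ℝ)
    (μ : Measure M) : Prop where
  isProb : IsProbabilityMeasure μ
  fullSupport : HasFullSupport μ
  moment : ∃ x : M, ∫⁻ y, edist x y ^ p ∂μ < ∞

/-- The set `𝒫^p(M)`. -/
def ProbP (p : ℝ) (M : Type*) [MetricSpace M] [MeasurableSpace M] : Type _ :=
  {μ : Measure M // IsProbPMoment p μ}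

/-- The couplings of `μ` and `ν`: Borel probability measures on the topological space `M × M`,
carried by their support, with marginals `μ` and `ν`. (For nonseparable `M` the Borel
`σ`-algebra of `M × M` may be larger than the product `σ`-algebra, hence it is written out.) -/
def couplings {M : Type*} [MetricSpace M] [MeasurableSpace M] (μ ν : Measure M) :
    Set (@Measure (M × M) (borel (M × M))) :=
  {π | @IsProbabilityMeasure (M × M) (borel (M × M)) π ∧
    @HasFullSupport (M × M) _ (borel (M × M)) π ∧
    (∀ B : Set M, MeasurableSet B → π (B ×ˢ univ) = μ B) ∧
    (∀ B : Set M, MeasurableSet B → π (univ ×ˢ B) = ν B)}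

/-- The `p`-Wasserstein distance `d_p^W(μ,ν) = [inf_π ∫ d(x,y)^p dπ(x,y)]^{1/p}`, with values in
`[0,∞]`. -/
def wassersteinDist {M : Type*} [MetricSpace M] [MeasurableSpace M] (p : ℝ)
    (μ ν : Measure M) : ℝ≥0∞ :=
  (⨅ π ∈ couplings μ ν, @lintegral (M × M) (borel (M × M)) π (fun z => edist z.1 z.2 ^ p))
    ^ (1 / p)

/-- The uniform measure `(1/(n+1)) ∑_j δ_{x_j}` on the `n+1` points `x_0, …, x_n`. -/
def uniformOn {M : Type*} [MeasurableSpace M] {n : ℕ} (x : Fin (n + 1) → M) : Measure M :=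
  ((n + 1 : ℕ) : ℝ≥0∞)⁻¹ • ∑ j, Measure.dirac (x j)

/-- Uniform measures on finite families belong to `𝒫^p(M)`. -/
lemma uniformOn_isProbPMoment {M : Type*} [MetricSpace M] [MeasurableSpace M] [BorelSpace M]
    {p : ℝ} (hp : 0 ≤ p) {n : ℕ} (x : Fin (n + 1) → M) : IsProbPMoment p (uniformOn x) := by
  have hn : ((n + 1 : ℕ) : ℝ≥0∞) ≠ 0 := by exact_mod_cast Nat.succ_ne_zero n
  have hn' : ((n + 1 : ℕ) : ℝ≥0∞) ≠ ∞ := ENNReal.natCast_ne_top _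
  refine ⟨⟨?_⟩, ?_, x 0, ?_⟩
  · simp only [uniformOn, Measure.smul_apply, Measure.finsetSum_apply, measure_univ,
      Finset.sum_const, Finset.card_univ, Fintype.card_fin, smul_eq_mul, nsmul_eq_mul, mul_one]
    exact ENNReal.inv_mul_cancel hn hn'
  · have hx : ∀ j, x j ∈ (uniformOn x).support := by
      intro j
      rw [Measure.mem_support_iff_forall]
      intro U hU
      have h1 : Measure.dirac (x j) U = 1 := Measure.dirac_apply_of_mem (mem_of_mem_nhds hU)
      have h2 : (1 : ℝ≥0∞) ≤ ∑ i, Measure.dirac (x i) U := by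
        rw [← h1]
        exact Finset.single_le_sum (f := fun i => Measure.dirac (x i) U)
          (fun _ _ => zero_le) (Finset.mem_univ j)
      simp only [uniformOn, Measure.smul_apply, Measure.finsetSum_apply, smul_eq_mul]
      exact ENNReal.mul_pos (ENNReal.inv_ne_zero.2 hn') (zero_lt_one.trans_le h2).ne'
    have hm : MeasurableSet ((uniformOn x).support)ᶜ :=
      Measure.isOpen_compl_support.measurableSet
    unfold HasFullSupport
    have h0 : ∀ j, Measure.dirac (x j) ((uniformOn x).support)ᶜ = 0 := by
      intro j
      rw [Measure.dirac_apply' _ hm]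
      simp [hx j]
    generalize (uniformOn x).support = S at *
    simp [uniformOn, h0]
  · simp only [uniformOn, lintegral_smul_measure, lintegral_finsetSum_measure,
      lintegral_dirac, smul_eq_mul]
    refine ENNReal.mul_lt_top (ENNReal.inv_lt_top.2 (pos_iff_ne_zero.2 hn)) ?_
    exact ENNReal.sum_lt_top.2
      (fun j _ => ENNReal.rpow_lt_top_of_nonneg hp (edist_ne_top _ _))

/-! ### Contractive barycentric maps -/

/-- `β : 𝒫^p(M) → M` is a `p`-contractive barycentric map: `β(δ_x) = x` for all `x`, and
`d(β(μ),β(ν)) ≤ d_p^W(μ,ν)` for all `μ, ν ∈ 𝒫^p(M)`. -/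
structure IsContractiveBarycentric {M : Type*} [MetricSpace M] [MeasurableSpace M] {p : ℝ}
    (β : ProbP p M → M) : Prop where
  map_dirac : ∀ (x : M) (μ : ProbP p M), μ.1 = Measure.dirac x → β μ = x
  contractive : ∀ μ ν : ProbP p M, edist (β μ) (β ν) ≤ wassersteinDist p μ.1 ν.1

/-- The set `𝒞_p(M)` of `p`-contractive barycentric maps. -/
def ContractiveBary (p : ℝ) (M : Type*) [MetricSpace M] [MeasurableSpace M] : Type _ :=
  {β : ProbP p M → M // IsContractiveBarycentric β}

/-- `d_p(β₁,β₂) = sup d(β₁(𝐱),β₂(𝐱)) / Δ(𝐱)`, the supremum being over all finite nonempty families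
`𝐱` of points with diameter `Δ(𝐱) ≠ 0`, where `β(𝐱)` is the value of `β` at the uniform measure
on `𝐱`. The value is in `[0,∞]`. (The condition `h` is always satisfied when `0 ≤ p`.) -/
def baryEDist {p : ℝ} {M : Type*} [MetricSpace M] [MeasurableSpace M]
    (β₁ β₂ : ContractiveBary p M) : ℝ≥0∞ :=
  ⨆ (n : ℕ) (x : Fin (n + 1) → M) (h : IsProbPMoment p (uniformOn x))
    (_ : Metric.diam (range x) ≠ 0),
    edist (β₁.1 ⟨uniformOn x, h⟩) (β₂.1 ⟨uniformOn x, h⟩) / ENNReal.ofReal (Metric.diam (range x))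

/-- `𝒞_p(M)` carries the distance `d_p` and its topology. -/
instance {p : ℝ} {M : Type*} [MetricSpace M] [MeasurableSpace M] :
    PseudoEMetricSpace (ContractiveBary p M) where
  edist := baryEDist
  edist_self β := by simp [baryEDist]
  edist_comm β₁ β₂ := by simp only [baryEDist, edist_comm]
  edist_triangle β₁ β₂ β₃ := by
    refine iSup_le fun n => iSup_le fun x => iSup_le fun h => iSup_le fun hx => ?_
    refine (ENNReal.div_le_div_right (edist_triangle _ (β₂.1 ⟨uniformOn x, h⟩) _) _).trans ?_
    rw [ENNReal.add_div]
    refine add_le_add ?_ ?_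
    · exact le_iSup_of_le n (le_iSup_of_le x (le_iSup_of_le h (le_iSup_of_le hx le_rfl)))
    · exact le_iSup_of_le n (le_iSup_of_le x (le_iSup_of_le h (le_iSup_of_le hx le_rfl)))

/-- `β` is the canonical barycentric map: for every `μ` and every base point `y`, the point
`β(μ)` is the unique minimizer of `z ↦ ∫ [d(z,x)² - d(y,x)²] dμ(x)`. (For `μ ∈ 𝒫^1(M)` the
integrand is integrable.) -/
def IsCanonicalBarycentricMap {p : ℝ} {M : Type*} [MetricSpace M] [MeasurableSpace M]
    (β : ContractiveBary p M) : Prop :=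
  ∀ (μ : ProbP p M) (y z : M), z ≠ β.1 μ →
    ∫ x, (dist (β.1 μ) x ^ 2 - dist y x ^ 2) ∂μ.1 < ∫ x, (dist z x ^ 2 - dist y x ^ 2) ∂μ.1

/-! ### The uniform convexity constants -/

/-- For `q > 2` the equation `x^{q-1} + (1-q) x + 2 - q = 0` has a unique solution in `(1,∞)`. -/
lemma existsUnique_tau {q : ℝ} (hq : 2 < q) :
    ∃! x : ℝ, 1 < x ∧ x ^ (q - 1) + (1 - q) * x + 2 - q = 0 := by
  have hcont : ContinuousOn (fun x : ℝ => x ^ (q - 1) + (1 - q) * x + 2 - q) (Ici 1) := by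
    have : ContinuousOn (fun x : ℝ => x ^ (q - 1)) (Ici 1) :=
      continuousOn_id.rpow_const fun x _ => Or.inr (by linarith)
    fun_prop
  obtain ⟨X, hX1, hX⟩ : ∃ X : ℝ, 1 ≤ X ∧ 0 ≤ X ^ (q - 1) + (1 - q) * X + 2 - q := by
    have h1 : (1 : ℝ) ≤ (2 * q) ^ (1 / (q - 2)) :=
      Real.one_le_rpow (by linarith) (by have : 0 < q - 2 := by linarith
                                         positivity)
    refine ⟨(2 * q) ^ (1 / (q - 2)), h1, ?_⟩
    set X := (2 * q) ^ (1 / (q - 2)) with hXdef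
    have h2 : X ^ (q - 2) = 2 * q := by
      rw [hXdef, ← Real.rpow_mul (by linarith), one_div_mul_cancel (by linarith), Real.rpow_one]
    have h3 : X ^ (q - 1) = 2 * q * X := by
      rw [show q - 1 = (q - 2) + 1 by ring, Real.rpow_add_one (by linarith), h2]
    rw [h3]
    nlinarith
  have hmem : (0 : ℝ) ∈ Icc ((1 : ℝ) ^ (q - 1) + (1 - q) * 1 + 2 - q)
      (X ^ (q - 1) + (1 - q) * X + 2 - q) := by
    refine ⟨?_, hX⟩
    rw [Real.one_rpow]; linarith
  obtain ⟨a, ha, ha0⟩ := intermediate_value_Icc hX1 (hcont.mono Icc_subset_Ici_self) hmem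
  have key : ∀ u v : ℝ, 1 < u → u < v → v ^ (q - 1) + (1 - q) * v + 2 - q = 0 →
      u ^ (q - 1) + (1 - q) * u + 2 - q < 0 := by
    intro u v hu huv hv
    have hd : 0 < v - 1 := by linarith
    have hc := (convexOn_rpow (show 1 ≤ q - 1 by linarith)).2 (mem_Ici.2 zero_le_one)
      (mem_Ici.2 (show (0 : ℝ) ≤ v by linarith))
      (div_nonneg (show 0 ≤ v - u by linarith) hd.le)
      (div_nonneg (show 0 ≤ u - 1 by linarith) hd.le)
      (by field_simp; ring)
    have hu' : ((v - u) / (v - 1)) • (1 : ℝ) + ((u - 1) / (v - 1)) • v = u := by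
      simp only [smul_eq_mul]; field_simp; ring
    rw [hu'] at hc
    simp only [Real.one_rpow, smul_eq_mul, mul_one] at hc
    have hv' : v ^ (q - 1) = (q - 1) * v + q - 2 := by linarith
    rw [hv'] at hc
    have h5 : (v - u) / (v - 1) + (u - 1) / (v - 1) * ((q - 1) * v + q - 2)
        = (q - 1) * u + q - 2 - (2 * q - 4) * ((v - u) / (v - 1)) := by
      field_simp; ring
    have h6 : 0 < (v - u) / (v - 1) := div_pos (by linarith) hd
    nlinarith
  refine ⟨a, ⟨lt_of_le_of_ne ha.1 ?_, ha0⟩, ?_⟩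
  · rintro rfl
    simp only [Real.one_rpow] at ha0
    linarith
  · rintro b ⟨hb1, hb0⟩
    have ha1 : 1 ≤ a := ha.1
    rcases lt_trichotomy b a with h | h | h
    · exact absurd hb0 (key b a hb1 h ha0).ne
    · exact h
    · rcases ha1.lt_or_eq with h1 | h1
      · exact absurd ha0 (key a b h1 h hb0).ne
      · subst h1
        simp only [Real.one_rpow] at ha0
        linarith

open Classical in
/-- `τ_q`, the unique solution in `(1,∞)` of `x^{q-1} + (1-q) x + 2 - q = 0`, for `q > 2`
(and `1` otherwise). -/
def convexityTau (q : ℝ) : ℝ :=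
  if hq : 2 < q then (existsUnique_tau hq).choose else 1

/-- `k_2 = 2` and `k_q = (8/2^q) (1 + τ_q^{q-1}) / (1 + τ_q)^{q-1}` for `q > 2`. -/
def convexityConst (q : ℝ) : ℝ :=
  if q = 2 then 2
  else 8 / 2 ^ q * ((1 + convexityTau q ^ (q - 1)) / (1 + convexityTau q) ^ (q - 1))

end

/-! The value `Φ_p(t, β)(μ)` is the fixed point of `x ↦ β(x #_t μ)`. Joint convexity of the distance
along geodesics makes this map Lipschitz with constant `1 - t < 1`, so Banach's theorem applies
(`IsGlobalNPC.existsUnique_fixed`). That `Φ_p(t, β)` is again `p`-contractive follows from the same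
convexity: for every coupling, `d(x,y)^p` is at most `(1-t) d(x,y)^p` plus `t` times the transport
cost, and the first term is absorbed. The semigroup law is uniqueness of the fixed point together
with `x #_s (x #_t a) = x #_{ts} a`.

The distance `d_p` only sees uniform measures, so all estimates reduce to averages over finite
families. The main one is the variance inequality `IsGlobalNPC.variance_flow`. It combines the
fixed-point equation, contractivity of `β` against a Dirac mass, Jensen's inequality and the uniform
convexity of `d^{2p}` (`IsGlobalNPC.uniform_convexity`). Adding the variance inequalities of `Φ_p(s,
β)` and `Φ_p(t, β)`, each tested at the other's value, gives the Hölder bound. That bound does not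
tend to `0` as `s → t`, so joint continuity rests instead on nonexpansiveness in `β`
(`IsGlobalNPC.edist_flow_le`) and a Lipschitz bound in the parameter
(`IsGlobalNPC.edist_flow_flow_le_abs`).

The constant `k_q` comes from the real line: `gradConst q` is the best constant in `|y|^q ≥ 1 +
q(y-1) + c|y-1|^q`. The bound passes to points of a line, then to triangles by convexity in the
squared third side, and to `M` through the NPC inequality.

For `p = 1`, the canonical map is built by minimizing the relative variance; its contractivity is
Reshetnyak's quadruple comparison. Since `k_2 = 2`, its variance inequality and that of the flow
cancel up to a term of order `t`, which gives `d_1(Φ_1(t, β), λ) ≤ √t`. -/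

/-! ### Geodesics in global NPC spaces -/

section Geodesic

variable {M : Type*} [MetricSpace M]

/-- `w` satisfies the NPC inequality of the point at parameter `t` between `x` and `y`. -/
def IsNPCPoint (x y : M) (t : ℝ) (w : M) : Prop :=
  ∀ z, dist z w ^ 2 ≤ (1 - t) * dist z x ^ 2 + t * dist z y ^ 2 - t * (1 - t) * dist x y ^ 2

lemma IsNPCPoint.dist_left_le {x y w : M} {t : ℝ} (h : IsNPCPoint x y t w) (ht : 0 ≤ t) :
    dist x w ≤ t * dist x y := by
  have := h x
  rw [dist_self] at this
  exact (abs_le_of_sq_le_sq' (by nlinarith) (by positivity)).2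

lemma IsNPCPoint.dist_right_le {x y w : M} {t : ℝ} (h : IsNPCPoint x y t w) (ht : t ≤ 1) :
    dist y w ≤ (1 - t) * dist x y := by
  have := h y
  rw [dist_self, dist_comm y x] at this
  exact (abs_le_of_sq_le_sq' (by nlinarith) (mul_nonneg (by linarith) dist_nonneg)).2

/-- The inequality for `w` is tested at `z = v`, with the endpoint distances of `v` inserted. -/
lemma IsNPCPoint.dist_le {x y v w : M} {s t : ℝ} (hv : IsNPCPoint x y s v)
    (hw : IsNPCPoint x y t w) (hs : s ∈ Icc (0 : ℝ) 1) (ht : t ∈ Icc (0 : ℝ) 1) :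
    dist v w ≤ |s - t| * dist x y := by
  have h1 := hw v
  have h2 := pow_le_pow_left₀ dist_nonneg (hv.dist_left_le hs.1) 2
  have h3 := pow_le_pow_left₀ dist_nonneg (hv.dist_right_le hs.2) 2
  rw [dist_comm v x, dist_comm v y] at h1
  have h4 := mul_le_mul_of_nonneg_left h2 (sub_nonneg.2 ht.2)
  have h5 := mul_le_mul_of_nonneg_left h3 ht.1
  refine (abs_le_of_sq_le_sq' ?_ (by positivity)).2
  rw [mul_pow, sq_abs]
  nlinarith

/-- The upper bounds on `d(x,v)`, `d(v,w)`, `d(w,y)` add up to exactly `d(x,y)`, so the triangle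
inequality forces equality. -/
lemma IsNPCPoint.dist_eq {x y v w : M} {s t : ℝ} (hv : IsNPCPoint x y s v)
    (hw : IsNPCPoint x y t w) (hs : s ∈ Icc (0 : ℝ) 1) (ht : t ∈ Icc (0 : ℝ) 1) :
    dist v w = |s - t| * dist x y := by
  wlog hst : s ≤ t generalizing s t v w
  · rw [dist_comm, abs_sub_comm]
    exact this hw hv ht hs (le_of_not_ge hst)
  refine le_antisymm (hv.dist_le hw hs ht) ?_
  have h1 := hv.dist_left_le hs.1
  have h2 := hw.dist_right_le ht.2
  have h3 := dist_triangle4 x v w y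
  rw [abs_of_nonpos (by linarith)]
  rw [dist_comm w y] at h3
  linarith

/-- Testing the inequality for `w` at `v` leaves `d(v,w)² ≤ 0`. This is the tool by which points on
geodesics are identified from here on. -/
lemma IsNPCPoint.eq_of_dist_le {x y v w : M} {t : ℝ} (hw : IsNPCPoint x y t w)
    (ht : t ∈ Icc (0 : ℝ) 1) (hx : dist x v ≤ t * dist x y) (hy : dist v y ≤ (1 - t) * dist x y) :
    v = w := by
  have h1 := hw v
  rw [dist_comm v x] at h1
  have h2 := pow_le_pow_left₀ dist_nonneg hx 2
  have h3 := pow_le_pow_left₀ dist_nonneg hy 2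
  have h4 := mul_le_mul_of_nonneg_left h2 (sub_nonneg.2 ht.2)
  have h5 := mul_le_mul_of_nonneg_left h3 ht.1
  have h6 : dist v w ^ 2 ≤ 0 := by nlinarith
  exact dist_eq_zero.1 (pow_eq_zero_iff two_ne_zero |>.1 (le_antisymm h6 (sq_nonneg _)))

lemma isNPCPoint_zero (x y : M) : IsNPCPoint x y 0 x := fun z => by simp

lemma isNPCPoint_one (x y : M) : IsNPCPoint x y 1 y := fun z => by simp

/-- The admissible parameters contain `0` and `1`, are stable under midpoints, and form a closed set
by completeness; such a set is all of `[0,1]`. -/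
lemma IsGlobalNPC.exists_isNPCPoint (hM : IsGlobalNPC M) (x y : M) {t : ℝ}
    (ht : t ∈ Icc (0 : ℝ) 1) : ∃ w, IsNPCPoint x y t w := by
  have := hM.complete
  set S : Set ℝ := {t | t ∈ Icc (0 : ℝ) 1 ∧ ∃ w, IsNPCPoint x y t w} with hS
  have h0 : (0 : ℝ) ∈ S := ⟨by simp, x, isNPCPoint_zero x y⟩
  have h1 : (1 : ℝ) ∈ S := ⟨by simp, y, isNPCPoint_one x y⟩
  have hmid : ∀ s ∈ S, ∀ t ∈ S, (s + t) / 2 ∈ S := by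
    rintro s ⟨hs, v, hv⟩ t ⟨ht, w, hw⟩
    refine ⟨⟨by linarith [hs.1, ht.1], by linarith [hs.2, ht.2]⟩, ?_⟩
    obtain ⟨m, hm⟩ := hM.exists_midpoint v w
    refine ⟨m, fun z => ?_⟩
    have h2 := hm z
    have h3 := hv z
    have h4 := hw z
    -- The exact value of `d(v,w)` is needed here: `(s-t)²/4` is what turns the mean of `s(1-s)` and
    -- `t(1-t)` into `r(1-r)` with `r = (s+t)/2`.
    rw [hv.dist_eq hw hs ht, mul_pow, sq_abs] at h2
    nlinarith
  have hcl : IsClosed S := by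
    refine isClosed_of_closure_subset fun t ht => ?_
    obtain ⟨u, hu, hut⟩ := mem_closure_iff_seq_limit.1 ht
    have htI : t ∈ Icc (0 : ℝ) 1 := isClosed_Icc.mem_of_tendsto hut (.of_forall fun n => (hu n).1)
    refine ⟨htI, ?_⟩
    choose w hw using fun n => (hu n).2
    have hc : CauchySeq w := by
      rw [Metric.cauchySeq_iff']
      intro ε hε
      have hD : 0 < dist x y + 1 := by positivity
      obtain ⟨N, hN⟩ := Metric.cauchySeq_iff'.1 hut.cauchySeq (ε / (dist x y + 1)) (by positivity)
      refine ⟨N, fun n hn => ?_⟩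
      have h2 := (hw n).dist_le (hw N) (hu n).1 (hu N).1
      have h3 := hN n hn
      rw [Real.dist_eq, lt_div_iff₀ hD] at h3
      nlinarith [abs_nonneg (u n - u N)]
    obtain ⟨a, ha⟩ := cauchySeq_tendsto_of_complete hc
    refine ⟨a, fun z => ?_⟩
    refine le_of_tendsto_of_tendsto' ((tendsto_const_nhds.dist ha).pow 2) ?_ fun n => hw n z
    exact (((tendsto_const_nhds.sub hut).mul_const _).add (hut.mul_const _)).sub
      ((hut.mul (tendsto_const_nhds.sub hut)).mul_const _)
  suffices t ∈ S from this.2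
  by_contra htS
  -- If `t` is missing, it lies in a maximal gap `(a,b)` of `S`, whose midpoint belongs to `S`.
  have hA : IsCompact (S ∩ Icc 0 t) := isCompact_Icc.inter_left hcl
  have hB : IsCompact (S ∩ Icc t 1) := isCompact_Icc.inter_left hcl
  obtain ⟨a, ha, hamax⟩ := hA.exists_isGreatest ⟨0, h0, by simp, ht.1⟩
  obtain ⟨b, hb, hbmin⟩ := hB.exists_isLeast ⟨1, h1, ht.2, by simp⟩
  have hat : a < t := lt_of_le_of_ne ha.2.2 fun h => htS (h ▸ ha.1)
  have htb : t < b := lt_of_le_of_ne hb.2.1 fun h => htS (h ▸ hb.1)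
  have hm := hmid a ha.1 b hb.1
  rcases le_total ((a + b) / 2) t with h | h
  · have := hamax ⟨hm, hm.1.1, h⟩
    linarith
  · have := hbmin ⟨hm, h, hm.1.2⟩
    linarith

/-- `geodPoint` uses an arbitrarily chosen geodesic, but every minimal geodesic must pass through
the NPC points by `IsNPCPoint.eq_of_dist_le`. -/
lemma IsGlobalNPC.isNPCPoint_geodPoint (hM : IsGlobalNPC M) (x y : M) {t : ℝ}
    (ht : t ∈ Icc (0 : ℝ) 1) : IsNPCPoint x y t (geodPoint x t y) := by
  have hex : ∃ γ : ℝ → M, IsMinimalGeodesic γ x y := by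
    have : ∀ t : ℝ, ∃ w, t ∈ Icc (0 : ℝ) 1 → IsNPCPoint x y t w := fun t => by
      by_cases ht : t ∈ Icc (0 : ℝ) 1
      · obtain ⟨w, hw⟩ := hM.exists_isNPCPoint x y ht
        exact ⟨w, fun _ => hw⟩
      · exact ⟨x, fun h => absurd h ht⟩
    choose γ hγ using this
    have h0 : (0 : ℝ) ∈ Icc (0 : ℝ) 1 := by simp
    have h1 : (1 : ℝ) ∈ Icc (0 : ℝ) 1 := by simp
    refine ⟨γ, ?_, ?_, fun s hs t ht => (hγ s hs).dist_eq (hγ t ht) hs ht⟩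
    · exact (hγ 0 h0).eq_of_dist_le h0 (by simp) (by simp) |>.symm
    · exact (hγ 1 h1).eq_of_dist_le h1 (by simp) (by simp) |>.symm
  obtain ⟨w, hw⟩ := hM.exists_isNPCPoint x y ht
  have h : geodPoint x t y = w := by
    unfold geodPoint
    rw [dif_pos hex]
    obtain ⟨h0, h1, h⟩ := hex.choose_spec
    refine hw.eq_of_dist_le ht ?_ ?_
    · have := h 0 (by simp) t ht
      rw [h0, zero_sub, abs_neg, abs_of_nonneg ht.1] at this
      exact this.le
    · have := h t ht 1 (by simp)
      rw [h1, abs_sub_comm, abs_of_nonneg (by linarith [ht.2])] at this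
      exact this.le
  exact h ▸ hw

lemma IsGlobalNPC.eq_geodPoint (hM : IsGlobalNPC M) {x y v : M} {t : ℝ} (ht : t ∈ Icc (0 : ℝ) 1)
    (hx : dist x v ≤ t * dist x y) (hy : dist v y ≤ (1 - t) * dist x y) : v = geodPoint x t y :=
  (hM.isNPCPoint_geodPoint x y ht).eq_of_dist_le ht hx hy

lemma IsGlobalNPC.dist_geodPoint_geodPoint (hM : IsGlobalNPC M) (x y : M) {s t : ℝ}
    (hs : s ∈ Icc (0 : ℝ) 1) (ht : t ∈ Icc (0 : ℝ) 1) :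
    dist (geodPoint x s y) (geodPoint x t y) = |s - t| * dist x y :=
  (hM.isNPCPoint_geodPoint x y hs).dist_eq (hM.isNPCPoint_geodPoint x y ht) hs ht

lemma IsGlobalNPC.geodPoint_zero (hM : IsGlobalNPC M) (x y : M) : geodPoint x 0 y = x :=
  (hM.eq_geodPoint (by simp) (by simp) (by simp)).symm

lemma IsGlobalNPC.geodPoint_one (hM : IsGlobalNPC M) (x y : M) : geodPoint x 1 y = y :=
  (hM.eq_geodPoint (by simp) (by simp) (by simp)).symm

lemma IsGlobalNPC.dist_left_geodPoint (hM : IsGlobalNPC M) (x y : M) {t : ℝ}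
    (ht : t ∈ Icc (0 : ℝ) 1) : dist x (geodPoint x t y) = t * dist x y := by
  have := hM.dist_geodPoint_geodPoint x y (s := 0) (by simp) ht
  rwa [hM.geodPoint_zero, zero_sub, abs_neg, abs_of_nonneg ht.1] at this

lemma IsGlobalNPC.dist_geodPoint_right (hM : IsGlobalNPC M) (x y : M) {t : ℝ}
    (ht : t ∈ Icc (0 : ℝ) 1) : dist (geodPoint x t y) y = (1 - t) * dist x y := by
  have := hM.dist_geodPoint_geodPoint x y (t := 1) ht (by simp)
  rwa [hM.geodPoint_one, abs_sub_comm, abs_of_nonneg (by linarith [ht.2])] at this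

lemma IsGlobalNPC.geodPoint_symm (hM : IsGlobalNPC M) (x y : M) {t : ℝ}
    (ht : t ∈ Icc (0 : ℝ) 1) : geodPoint x t y = geodPoint y (1 - t) x := by
  refine hM.eq_geodPoint ⟨by linarith [ht.2], by linarith [ht.1]⟩ ?_ ?_
  · rw [dist_comm, hM.dist_geodPoint_right x y ht, dist_comm]
  · rw [dist_comm, hM.dist_left_geodPoint x y ht, dist_comm x y, sub_sub_cancel]

lemma IsGlobalNPC.geodPoint_geodPoint (hM : IsGlobalNPC M) (x y : M) {s t : ℝ}
    (hs : s ∈ Icc (0 : ℝ) 1) (ht : t ∈ Icc (0 : ℝ) 1) :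
    geodPoint x s (geodPoint x t y) = geodPoint x (t * s) y := by
  refine hM.eq_geodPoint ⟨mul_nonneg ht.1 hs.1, mul_le_one₀ ht.2 hs.1 hs.2⟩ ?_ ?_
  · rw [hM.dist_left_geodPoint _ _ hs, hM.dist_left_geodPoint _ _ ht]
    linarith
  · refine (dist_triangle _ (geodPoint x t y) _).trans ?_
    rw [hM.dist_geodPoint_right _ _ hs, hM.dist_geodPoint_right _ _ ht,
      hM.dist_left_geodPoint _ _ ht]
    linarith

/-- The inequality on the geodesic from `x` to `b` is tested at `x #_t a`, and the one from `x` to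
`a` at `b`. Adding `t` times the second to the first cancels `d(x,a)²` and `d(x,b)²`, leaving `t²
d(a,b)²`. -/
lemma IsGlobalNPC.dist_geodPoint_right_le (hM : IsGlobalNPC M) (x a b : M) {t : ℝ}
    (ht : t ∈ Icc (0 : ℝ) 1) :
    dist (geodPoint x t a) (geodPoint x t b) ≤ t * dist a b := by
  have h1 := hM.isNPCPoint_geodPoint x b ht (geodPoint x t a)
  have h2 := hM.isNPCPoint_geodPoint x a ht b
  rw [dist_comm (geodPoint x t a) x, hM.dist_left_geodPoint x a ht,
    dist_comm (geodPoint x t a) b] at h1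
  rw [dist_comm b x, dist_comm b a] at h2
  have h3 := mul_le_mul_of_nonneg_left h2 ht.1
  refine (abs_le_of_sq_le_sq' ?_ (mul_nonneg ht.1 dist_nonneg)).2
  nlinarith

/-- The endpoints are moved one at a time, reversing the geodesic to move the initial one. -/
lemma IsGlobalNPC.dist_geodPoint_le (hM : IsGlobalNPC M) (x y a b : M) {t : ℝ}
    (ht : t ∈ Icc (0 : ℝ) 1) :
    dist (geodPoint x t a) (geodPoint y t b) ≤ (1 - t) * dist x y + t * dist a b := by
  refine (dist_triangle _ (geodPoint x t b) _).trans ?_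
  have h1 := hM.dist_geodPoint_right_le x a b ht
  have h2 := hM.dist_geodPoint_right_le b x y (t := 1 - t) ⟨by linarith [ht.2], by linarith [ht.1]⟩
  rw [← hM.geodPoint_symm x b ht, ← hM.geodPoint_symm y b ht] at h2
  linarith

lemma IsGlobalNPC.continuous_geodPoint (hM : IsGlobalNPC M) (x : M) {t : ℝ}
    (ht : t ∈ Icc (0 : ℝ) 1) : Continuous fun a => geodPoint x t a :=
  (LipschitzWith.of_dist_le_mul (K := ⟨t, ht.1⟩)
    fun a b => hM.dist_geodPoint_right_le x a b ht).continuous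

/-- Reshetnyak's quadruple comparison. -/
lemma IsGlobalNPC.quadruple (hM : IsGlobalNPC M) (a b c d : M) :
    dist a c ^ 2 + dist b d ^ 2 ≤
      dist a d ^ 2 + dist b c ^ 2 + 2 * dist a b * dist c d := by
  rcases eq_or_ne a b with rfl | hab
  · simp only [dist_self]; linarith
  rcases eq_or_ne c d with rfl | hcd
  · simp only [dist_self]; linarith
  have hl : 0 < dist a b := dist_pos.2 hab
  have hm : 0 < dist c d := dist_pos.2 hcd
  set l := dist a b
  set m := dist c d
  have hs : l / (l + m) ∈ Icc (0 : ℝ) 1 :=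
    ⟨by positivity, (div_le_one (by positivity)).2 (by linarith)⟩
  -- The path from `a` to `c` is routed through this point of the geodesic from `b` to `d`; the
  -- ratio `l : m` makes the weighted squares of its two legs add up to the claimed bound.
  set w := geodPoint b (l / (l + m)) d
  have h1 := hM.isNPCPoint_geodPoint b d hs a
  have h2 := hM.isNPCPoint_geodPoint b d hs c
  have h3 := dist_triangle a w c
  rw [dist_comm w c] at h3
  change dist a w ^ 2 ≤ _ at h1
  change dist c w ^ 2 ≤ _ at h2
  have e : 1 - l / (l + m) = m / (l + m) := by field_simp; ring
  rw [e] at h1 h2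
  have h4 : dist a c ^ 2 ≤ (l + m) / l * dist a w ^ 2 + (l + m) / m * dist c w ^ 2 := by
    refine (pow_le_pow_left₀ dist_nonneg h3 2).trans ?_
    rw [← sub_nonneg]
    have : (l + m) / l * dist a w ^ 2 + (l + m) / m * dist c w ^ 2 - (dist a w + dist c w) ^ 2
        = (m * dist a w - l * dist c w) ^ 2 / (l * m) := by
      field_simp; ring
    rw [this]; positivity
  have h5 := mul_le_mul_of_nonneg_left h1 (show 0 ≤ (l + m) / l by positivity)
  have h6 := mul_le_mul_of_nonneg_left h2 (show 0 ≤ (l + m) / m by positivity)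
  have h7 : (l + m) / l * (m / (l + m) * l ^ 2 + l / (l + m) * dist a d ^ 2
      - l / (l + m) * (m / (l + m)) * dist b d ^ 2)
      + (l + m) / m * (m / (l + m) * dist c b ^ 2 + l / (l + m) * m ^ 2
      - l / (l + m) * (m / (l + m)) * dist b d ^ 2)
      = 2 * l * m + dist a d ^ 2 + dist c b ^ 2 - dist b d ^ 2 := by
    field_simp; ring
  rw [dist_comm c b] at *
  change (l + m) / l * dist a w ^ 2 ≤ (l + m) / l * (m / (l + m) * l ^ 2 + _ - _) at h5
  change (l + m) / m * dist c w ^ 2 ≤ (l + m) / m * (_ + _ * m ^ 2 - _) at h6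
  linarith

end Geodesic

/-! ### The uniform convexity inequality -/

section Convexity

/-- The best constant in the gradient inequality for `|x|^q` on the real line. -/
noncomputable def gradConst (q : ℝ) : ℝ :=
  (1 + convexityTau q ^ (q - 1)) / (1 + convexityTau q) ^ (q - 1)

lemma convexityTau_spec {q : ℝ} (hq : 2 < q) : 1 < convexityTau q ∧
    convexityTau q ^ (q - 1) + (1 - q) * convexityTau q + 2 - q = 0 := by
  unfold convexityTau
  rw [dif_pos hq]
  exact (existsUnique_tau hq).choose_spec.1

lemma gradConst_nonneg {q : ℝ} (hq : 2 < q) : 0 ≤ gradConst q := by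
  have := (convexityTau_spec hq).1
  unfold gradConst
  positivity

lemma add_rpow_le_rpow_add' {a b r : ℝ} (ha : 0 ≤ a) (hb : 0 ≤ b) (hr : 1 ≤ r) :
    a ^ r + b ^ r ≤ (a + b) ^ r := by
  lift a to NNReal using ha
  lift b to NNReal using hb
  exact_mod_cast NNReal.add_rpow_le_rpow_add a b hr

lemma gradConst_le_one {q : ℝ} (hq : 2 < q) : gradConst q ≤ 1 := by
  have := (convexityTau_spec hq).1
  unfold gradConst
  refine (div_le_one (by positivity)).2 ?_
  have := add_rpow_le_rpow_add' zero_le_one (show 0 ≤ convexityTau q by linarith)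
    (show 1 ≤ q - 1 by linarith)
  rwa [Real.one_rpow] at this

/-- The sign of the polynomial defining `τ_q` is negative before `τ_q` and positive after. -/
lemma tau_sign {q : ℝ} (hq : 2 < q) {s : ℝ} (hs : 0 ≤ s) :
    (s ≤ convexityTau q → s ^ (q - 1) + (1 - q) * s + 2 - q ≤ 0) ∧
    (convexityTau q ≤ s → 0 ≤ s ^ (q - 1) + (1 - q) * s + 2 - q) := by
  obtain ⟨h1, h2⟩ := convexityTau_spec hq
  set τ := convexityTau q
  have hτ : 0 < τ := by linarith
  have hconv := convexOn_rpow (show 1 ≤ q - 1 by linarith)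
  constructor
  · intro h
    -- The function is convex, equal to `2 - q < 0` at `0` and to `0` at `τ`: `s` is interpolated
    -- between `0` and `τ`, and in the second part `τ` between `0` and `s`.
    have hc := hconv.2 (mem_Ici.2 le_rfl) (mem_Ici.2 hτ.le)
      (show 0 ≤ 1 - s / τ by rw [sub_nonneg]; exact (div_le_one hτ).2 h)
      (show 0 ≤ s / τ by positivity) (by ring)
    simp only [smul_eq_mul, mul_zero, zero_add, Real.zero_rpow (show q - 1 ≠ 0 by linarith)] at hc
    rw [div_mul_cancel₀ _ hτ.ne', show τ ^ (q - 1) = (q - 1) * τ + q - 2 by linarith] at hc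
    have e : s / τ * ((q - 1) * τ + q - 2) = (q - 1) * s + (q - 2) * (s / τ) := by
      field_simp; ring
    have h3 : s / τ ≤ 1 := (div_le_one hτ).2 h
    nlinarith
  · intro h
    have hs0 : 0 < s := by linarith
    have hc := hconv.2 (mem_Ici.2 le_rfl) (mem_Ici.2 hs)
      (show 0 ≤ 1 - τ / s by rw [sub_nonneg]; exact (div_le_one hs0).2 h)
      (show 0 ≤ τ / s by positivity) (by ring)
    simp only [smul_eq_mul, mul_zero, zero_add, Real.zero_rpow (show q - 1 ≠ 0 by linarith)] at hc
    rw [div_mul_cancel₀ _ hs0.ne', show τ ^ (q - 1) = (q - 1) * τ + q - 2 by linarith,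
      div_mul_eq_mul_div, le_div_iff₀ hs0] at hc
    have h4 : τ * ((q - 1) * s + q - 2) ≤ τ * s ^ (q - 1) := by nlinarith
    have := le_of_mul_le_mul_left h4 hτ
    linarith

/-- The quotient of `s^q + qs + q - 1` by `(1+s)^q` has a derivative with the sign of the polynomial
defining `τ_q`, so it is minimal at `τ_q`, where it equals `gradConst q`. -/
lemma gradient_ineq_neg {q : ℝ} (hq : 2 < q) {s : ℝ} (hs : 0 ≤ s) :
    gradConst q * (1 + s) ^ q ≤ s ^ q + q * s + q - 1 := by
  obtain ⟨h1, h2⟩ := convexityTau_spec hq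
  set τ := convexityTau q with hτdef
  set R : ℝ → ℝ := fun s => (s ^ q + q * s + q - 1) / (1 + s) ^ q with hR
  have hRτ : R τ = gradConst q := by
    have h3 : 0 < 1 + τ := by linarith
    have e1 : τ ^ q = τ ^ (q - 1) * τ := by
      rw [← Real.rpow_add_one (by linarith)]; ring_nf
    have e2 : (1 + τ) ^ q = (1 + τ) ^ (q - 1) * (1 + τ) := by
      rw [← Real.rpow_add_one h3.ne']; ring_nf
    simp only [hR, gradConst]
    rw [← hτdef, e1, e2, show τ ^ (q - 1) = (q - 1) * τ + q - 2 by linarith]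
    have : 0 < (1 + τ) ^ (q - 1) := by positivity
    field_simp
    ring
  have hder : ∀ u : ℝ, 0 < u → HasDerivAt R
      (q * (1 + u) ^ (q - 1) * (u ^ (q - 1) + (1 - q) * u + 2 - q) / ((1 + u) ^ q) ^ 2) u := by
    intro u hu
    have h3 : 0 < 1 + u := by linarith
    have d1 : HasDerivAt (fun s : ℝ => s ^ q + q * s + q - 1) (q * u ^ (q - 1) + q) u := by
      have := (((Real.hasDerivAt_rpow_const (p := q) (Or.inl hu.ne')).add
        ((hasDerivAt_id u).const_mul q)).add_const q).sub_const 1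
      simpa using this
    have d2 : HasDerivAt (fun s : ℝ => (1 + s) ^ q) (q * (1 + u) ^ (q - 1)) u := by
      have := ((hasDerivAt_id u).const_add 1).rpow_const (p := q) (Or.inl h3.ne')
      simpa using this
    refine (d1.div d2 (by positivity)).congr_deriv ?_
    congr 1
    have e1 : u ^ q = u ^ (q - 1) * u := by
      rw [← Real.rpow_add_one hu.ne']; ring_nf
    have e2 : (1 + u) ^ q = (1 + u) ^ (q - 1) * (1 + u) := by
      rw [← Real.rpow_add_one h3.ne']; ring_nf
    rw [e1, e2]
    ring
  have hcont : ContinuousOn R (Ici 0) := by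
    refine ContinuousOn.div ?_ ?_ ?_
    · have : ContinuousOn (fun s : ℝ => s ^ q) (Ici 0) :=
        continuousOn_id.rpow_const fun x _ => Or.inr (by linarith)
      fun_prop
    · exact (continuousOn_const.add continuousOn_id).rpow_const fun x _ => Or.inr (by linarith)
    · intro x hx
      have : 0 < 1 + x := by linarith [mem_Ici.1 hx]
      positivity
  have key : gradConst q ≤ R s := by
    rw [← hRτ]
    rcases le_total s τ with h | h
    · have : AntitoneOn R (Icc 0 τ) := by
        refine antitoneOn_of_deriv_nonpos (convex_Icc 0 τ) (hcont.mono Icc_subset_Ici_self) ?_ ?_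
        · intro u hu
          rw [interior_Icc] at hu
          exact (hder u hu.1).differentiableAt.differentiableWithinAt
        · intro u hu
          rw [interior_Icc] at hu
          rw [(hder u hu.1).deriv]
          have h3 : 0 < 1 + u := by linarith [hu.1]
          refine div_nonpos_of_nonpos_of_nonneg ?_ (by positivity)
          exact mul_nonpos_of_nonneg_of_nonpos (by positivity) ((tau_sign hq hu.1.le).1 hu.2.le)
      exact this ⟨hs, h⟩ ⟨by linarith, le_rfl⟩ h
    · have : MonotoneOn R (Ici τ) := by
        refine monotoneOn_of_deriv_nonneg (convex_Ici τ)
          (hcont.mono (Ici_subset_Ici.2 (by linarith))) ?_ ?_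
        · intro u hu
          rw [interior_Ici] at hu
          exact (hder u (by linarith [mem_Ioi.1 hu])).differentiableAt.differentiableWithinAt
        · intro u hu
          rw [interior_Ici] at hu
          have h4 : 0 < u := by linarith [mem_Ioi.1 hu]
          rw [(hder u h4).deriv]
          have h3 : 0 < 1 + u := by linarith
          refine div_nonneg ?_ (by positivity)
          exact mul_nonneg (by positivity) ((tau_sign hq h4.le).2 (mem_Ioi.1 hu).le)
      exact this self_mem_Ici h h
  rwa [hR, le_div_iff₀ (by positivity)] at key

lemma abs_rpow_eq_sq_rpow (x q : ℝ) : |x| ^ q = (x ^ 2) ^ (q / 2) := by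
  rw [← sq_abs, ← Real.rpow_natCast, ← Real.rpow_mul (abs_nonneg x)]
  congr 1
  push_cast
  ring

/-- The gradient inequality for `|y|^q` at the point `1`. -/
lemma gradient_ineq_one {q : ℝ} (hq : 2 < q) (y : ℝ) :
    1 + q * (y - 1) + gradConst q * |y - 1| ^ q ≤ |y| ^ q := by
  have hc := gradConst_le_one hq
  -- Only `y ≤ 0` needs the sharp constant. For `y > 0` the constant `1` suffices: Bernoulli's
  -- inequality for `(y²)^{q/2}` when `y ≤ 1`, and superadditivity applied to `y² = (1+2h) + h²`
  -- when `y > 1`.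
  rcases le_or_gt y 0 with h | h
  · have := gradient_ineq_neg hq (s := -y) (by linarith)
    rw [abs_of_nonpos h, abs_of_nonpos (show y - 1 ≤ 0 by linarith),
      show -(y - 1) = 1 + -y by ring]
    linarith
  rcases le_or_gt y 1 with h' | h'
  · have h1 : |y - 1| ^ q ≤ (y - 1) ^ 2 := by
      rw [← sq_abs, ← Real.rpow_natCast]
      refine Real.rpow_le_rpow_of_exponent_ge' (abs_nonneg _) ?_ (by norm_num)
        (by push_cast; linarith)
      rw [abs_of_nonpos (by linarith)]; linarith
    have h2 := one_add_mul_self_le_rpow_one_add (s := y ^ 2 - 1) (by nlinarith)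
      (show 1 ≤ q / 2 by linarith)
    rw [add_sub_cancel, ← abs_rpow_eq_sq_rpow] at h2
    have h3 : gradConst q * |y - 1| ^ q ≤ 1 * |y - 1| ^ q := by gcongr
    nlinarith [sq_nonneg (y - 1)]
  · set h := y - 1 with hh
    have hy : y = 1 + h := by ring
    have hpos : 0 < h := by linarith
    have h2 := one_add_mul_self_le_rpow_one_add (s := 2 * h) (by linarith)
      (show 1 ≤ q / 2 by linarith)
    have h4 := add_rpow_le_rpow_add' (show 0 ≤ 1 + 2 * h by linarith) (sq_nonneg h)
      (show 1 ≤ q / 2 by linarith)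
    rw [← abs_rpow_eq_sq_rpow, show 1 + 2 * h + h ^ 2 = y ^ 2 by rw [hy]; ring,
      ← abs_rpow_eq_sq_rpow] at h4
    have h3 : gradConst q * |h| ^ q ≤ 1 * |h| ^ q := by gcongr
    nlinarith

/-- The convexity defect of `|x|^q` on the real line. -/
lemma line_convexity {q : ℝ} (hq : 2 < q) {t : ℝ} (ht : t ∈ Icc (0 : ℝ) 1) (x y : ℝ) :
    |(1 - t) * x + t * y| ^ q + 4 / 2 ^ q * gradConst q * (t * (1 - t)) * |x - y| ^ q ≤
      (1 - t) * |x| ^ q + t * |y| ^ q := by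
  have hc0 := gradConst_nonneg hq
  have hc1 := gradConst_le_one hq
  obtain ⟨ht0, ht1⟩ := ht
  have ht2 : 0 ≤ 1 - t := by linarith
  set w := (1 - t) * x + t * y with hw
  -- After division by `t(1-t)` this is midpoint convexity of `u^{q-1}` at `t` and `1 - t`; it is
  -- where the factor `4/2^q` comes from.
  have hW : 4 / 2 ^ q * (t * (1 - t)) ≤ (1 - t) * t ^ q + t * (1 - t) ^ q := by
    have hconv := (convexOn_rpow (show 1 ≤ q - 1 by linarith)).2 (mem_Ici.2 ht0) (mem_Ici.2 ht2)
      (show (0 : ℝ) ≤ 1 / 2 by norm_num) (show (0 : ℝ) ≤ 1 / 2 by norm_num) (by norm_num)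
    simp only [smul_eq_mul] at hconv
    rw [show 1 / 2 * t + 1 / 2 * (1 - t) = (2 : ℝ)⁻¹ by ring,
      Real.inv_rpow (by norm_num), Real.rpow_sub_one (by norm_num)] at hconv
    have e : ∀ u : ℝ, 0 ≤ u → u ^ q = u ^ (q - 1) * u := fun u hu => by
      rw [← Real.rpow_add_one' hu (by linarith)]; ring_nf
    rw [e t ht0, e (1 - t) ht2]
    have h2 : 4 / 2 ^ q ≤ t ^ (q - 1) + (1 - t) ^ (q - 1) := by
      have : (4 : ℝ) / 2 ^ q = 2 * ((2 ^ q / 2)⁻¹) := by rw [inv_div]; ring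
      linarith
    nlinarith [mul_nonneg ht0 ht2]
  -- homogeneous gradient inequality at the point `w`
  have hgrad : ∃ D : ℝ, ∀ z, |w| ^ q + D * (z - w) + gradConst q * |z - w| ^ q ≤ |z| ^ q := by
    rcases eq_or_ne w 0 with h0 | h0
    · refine ⟨0, fun z => ?_⟩
      rw [h0, abs_zero, Real.zero_rpow (by linarith), sub_zero]
      have : gradConst q * |z| ^ q ≤ 1 * |z| ^ q := by gcongr
      linarith
    · refine ⟨|w| ^ q * q / w, fun z => ?_⟩
      have h1 := mul_le_mul_of_nonneg_left (gradient_ineq_one hq (z / w))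
        (show 0 ≤ |w| ^ q by positivity)
      have e1 : |w| ^ q * |z / w| ^ q = |z| ^ q := by
        rw [← Real.mul_rpow (abs_nonneg _) (abs_nonneg _), ← abs_mul, mul_div_cancel₀ _ h0]
      have e2 : |w| ^ q * |z / w - 1| ^ q = |z - w| ^ q := by
        rw [← Real.mul_rpow (abs_nonneg _) (abs_nonneg _), ← abs_mul, mul_sub,
          mul_div_cancel₀ _ h0, mul_one]
      rw [e1] at h1
      rw [← e2]
      have e3 : |w| ^ q * q / w * (z - w) = |w| ^ q * (q * (z / w - 1)) := by
        field_simp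
      rw [e3]
      linarith
  obtain ⟨D, hD⟩ := hgrad
  have h1 := mul_le_mul_of_nonneg_left (hD x) ht2
  have h2 := mul_le_mul_of_nonneg_left (hD y) ht0
  have e1 : |x - w| ^ q = t ^ q * |x - y| ^ q := by
    rw [show x - w = t * (x - y) by rw [hw]; ring, abs_mul, abs_of_nonneg ht0,
      Real.mul_rpow ht0 (abs_nonneg _)]
  have e2 : |y - w| ^ q = (1 - t) ^ q * |x - y| ^ q := by
    rw [show y - w = (1 - t) * (y - x) by rw [hw]; ring, abs_mul, abs_of_nonneg ht2,
      Real.mul_rpow ht2 (abs_nonneg _), abs_sub_comm]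
  rw [e1] at h1
  rw [e2] at h2
  have h3 := mul_le_mul_of_nonneg_right hW
    (mul_nonneg hc0 (show 0 ≤ |x - y| ^ q by positivity))
  -- Since `w` is the weighted mean of `x` and `y`, the linear terms of the two gradient
  -- inequalities cancel.
  have e3 : (1 - t) * (D * (x - w)) + t * (D * (y - w)) = 0 := by rw [hw]; ring
  nlinarith

lemma convexityConst_two : convexityConst 2 = 2 := by simp [convexityConst]

lemma convexityConst_eq {q : ℝ} (hq : 2 < q) : convexityConst q / 2 = 4 / 2 ^ q * gradConst q := by
  rw [convexityConst, if_neg hq.ne', gradConst]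
  ring

lemma convexityConst_nonneg {q : ℝ} (hq : 2 ≤ q) : 0 ≤ convexityConst q := by
  rcases hq.eq_or_lt with rfl | h
  · simp [convexityConst_two]
  · have h1 := convexityConst_eq h
    have h2 : 0 ≤ 4 / 2 ^ q * gradConst q := mul_nonneg (by positivity) (gradConst_nonneg h)
    linarith

lemma convexityConst_le_two {q : ℝ} (hq : 2 ≤ q) : convexityConst q ≤ 2 := by
  rcases hq.eq_or_lt with rfl | h
  · simp [convexityConst_two]
  · have h1 := convexityConst_eq h
    have h2 : (4 : ℝ) / 2 ^ q ≤ 1 := by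
      refine (div_le_one (by positivity)).2 ?_
      calc (4 : ℝ) = 2 ^ (2 : ℝ) := by norm_num
        _ ≤ 2 ^ q := Real.rpow_le_rpow_of_exponent_le (by norm_num) hq
    have h3 : 4 / 2 ^ q * gradConst q ≤ 1 :=
      mul_le_one₀ h2 (gradConst_nonneg h) (gradConst_le_one h)
    linarith

/-- The plane version: `a`, `b`, `c` are the sides of a triangle. -/
lemma triangle_convexity {q : ℝ} (hq : 2 < q) {t : ℝ} (ht : t ∈ Icc (0 : ℝ) 1) {a b c : ℝ}
    (ha : 0 ≤ a) (hb : 0 ≤ b) (hc : 0 ≤ c) (h1 : |a - b| ≤ c) (h2 : c ≤ a + b) :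
    ((1 - t) * a ^ 2 + t * b ^ 2 - t * (1 - t) * c ^ 2) ^ (q / 2)
        + 4 / 2 ^ q * gradConst q * (t * (1 - t)) * c ^ q ≤ (1 - t) * a ^ q + t * b ^ q := by
  obtain ⟨ht0, ht1⟩ := ht
  have ht2 : 0 ≤ 1 - t := by linarith
  set K := 4 / 2 ^ q * gradConst q * (t * (1 - t)) with hK
  have hK0 : 0 ≤ K := by
    have := gradConst_nonneg hq
    positivity
  have hl1 := line_convexity hq ⟨ht0, ht1⟩ a b
  have hl2 := line_convexity hq ⟨ht0, ht1⟩ a (-b)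
  rw [abs_neg] at hl2
  rw [abs_of_nonneg ha, abs_of_nonneg hb, ← hK] at hl1 hl2
  rw [abs_rpow_eq_sq_rpow, abs_rpow_eq_sq_rpow (a - b)] at hl1
  rw [abs_rpow_eq_sq_rpow, abs_rpow_eq_sq_rpow (a - -b)] at hl2
  have ec : c ^ q = (c ^ 2) ^ (q / 2) := by rw [← abs_rpow_eq_sq_rpow, abs_of_nonneg hc]
  rw [ec]
  have hu1 : (a - b) ^ 2 ≤ c ^ 2 := by rw [← sq_abs (a - b)]; gcongr
  have hu2 : c ^ 2 ≤ (a - -b) ^ 2 := by rw [sub_neg_eq_add]; gcongr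
  have hr : 1 ≤ q / 2 := by linarith
  -- The base of the power on the left is affine in `c²`, so the whole left side is convex in `c²`,
  -- while the right side does not involve `c`. It is enough to treat the degenerate triangles `c =
  -- |a - b|` and `c = a + b`, which are the line inequality at `(a, b)` and `(a, -b)`.
  have hseg : c ^ 2 ∈ segment ℝ ((a - b) ^ 2) ((a - -b) ^ 2) := by
    rw [segment_eq_Icc (hu1.trans hu2)]; exact ⟨hu1, hu2⟩
  obtain ⟨α, β, hα, hβ, hαβ, hcomb⟩ := hseg
  have hconv := convexOn_rpow hr
  have k1 := hconv.2 (mem_Ici.2 (sq_nonneg (a - b))) (mem_Ici.2 (sq_nonneg (a - -b))) hα hβ hαβ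
  have k2 := hconv.2 (mem_Ici.2 (sq_nonneg ((1 - t) * a + t * b)))
    (mem_Ici.2 (sq_nonneg ((1 - t) * a + t * -b))) hα hβ hαβ
  simp only [smul_eq_mul] at k1 k2 hcomb
  rw [hcomb] at k1
  have e : α * ((1 - t) * a + t * b) ^ 2 + β * ((1 - t) * a + t * -b) ^ 2
      = (1 - t) * a ^ 2 + t * b ^ 2 - t * (1 - t) * c ^ 2 := by
    rw [← hcomb]
    have : α = 1 - β := by linarith
    rw [this]; ring
  rw [e] at k2
  have m1 := mul_le_mul_of_nonneg_left k1 hK0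
  have m2 := mul_le_mul_of_nonneg_left hl1 hα
  have m3 := mul_le_mul_of_nonneg_left hl2 hβ
  have m4 : α * ((1 - t) * a ^ q + t * b ^ q) + β * ((1 - t) * a ^ q + t * b ^ q)
      = (1 - t) * a ^ q + t * b ^ q := by rw [← add_mul, hαβ, one_mul]
  nlinarith

/-- `2p`-uniform convexity of the distance in a global NPC space. -/
lemma IsGlobalNPC.uniform_convexity {M : Type*} [MetricSpace M] (hM : IsGlobalNPC M) {q : ℝ}
    (hq : 2 ≤ q) {t : ℝ} (ht : t ∈ Icc (0 : ℝ) 1) (x y z : M) :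
    dist z (geodPoint x t y) ^ q ≤ (1 - t) * dist z x ^ q + t * dist z y ^ q
      - convexityConst q / 2 * (t * (1 - t)) * dist x y ^ q := by
  have h := hM.isNPCPoint_geodPoint x y ht z
  rcases hq.eq_or_lt with rfl | hq
  · simp only [Real.rpow_two, convexityConst_two]
    linarith
  · rw [convexityConst_eq hq]
    have h1 := triangle_convexity hq ht (dist_nonneg (x := z) (y := x))
      (dist_nonneg (x := z) (y := y)) (dist_nonneg (x := x) (y := y))
      (by rw [dist_comm z x, dist_comm z y]; exact abs_dist_sub_le x y z)
      (by rw [dist_comm z x]; exact dist_triangle x z y)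
    have h2 := Real.rpow_le_rpow (sq_nonneg _) h (show 0 ≤ q / 2 by linarith)
    rw [← abs_rpow_eq_sq_rpow, abs_of_nonneg dist_nonneg] at h2
    linarith

end Convexity

/-! ### Couplings and barycentric maps -/

section Measures

lemma HasFullSupport.map {X Y : Type*} [TopologicalSpace X] [MeasurableSpace X]
    [TopologicalSpace Y] [MeasurableSpace Y] [OpensMeasurableSpace Y] {μ : Measure X}
    (h : HasFullSupport μ) {f : X → Y} (hf : Continuous f) (hm : Measurable f) :
    HasFullSupport (μ.map f) := by
  unfold HasFullSupport at *
  have hms : MeasurableSet ((μ.map f).support)ᶜ := Measure.isOpen_compl_support.measurableSet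
  rw [Measure.map_apply hm hms]
  refine measure_mono_null ?_ h
  intro x hx hxs
  refine hx ?_
  rw [Measure.mem_support_iff_forall] at hxs ⊢
  intro U hU
  exact (hxs _ (hf.continuousAt.preimage_mem_nhds hU)).trans_le
    (Measure.le_map_apply hm.aemeasurable U)

variable {M : Type*} [MetricSpace M] [MeasurableSpace M] [BorelSpace M]

/-- The push-forward of `π` by `(f, g)` is a coupling. With `le_wassersteinDist` this replaces
couplings by pairs of continuous maps on an auxiliary space, keeping the Borel `σ`-algebra of `M ×
M` out of later arguments. -/
lemma wassersteinDist_map_le {X : Type*} [TopologicalSpace X] [MeasurableSpace X]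
    [OpensMeasurableSpace X] {p : ℝ} (hp : 0 ≤ p) (π : Measure X) [IsProbabilityMeasure π]
    (hπ : HasFullSupport π) {f g : X → M} (hf : Continuous f) (hg : Continuous g) :
    wassersteinDist p (π.map f) (π.map g) ≤ (∫⁻ x, edist (f x) (g x) ^ p ∂π) ^ (1 / p) := by
  let _ : MeasurableSpace (M × M) := borel (M × M)
  have : BorelSpace (M × M) := ⟨rfl⟩
  have hfg : Continuous fun x => (f x, g x) := hf.prodMk hg
  refine ENNReal.rpow_le_rpow ?_ (by positivity)
  have hmem : π.map (fun x => (f x, g x)) ∈ couplings (π.map f) (π.map g) := ?_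
  · refine (iInf₂_le _ hmem).trans ?_
    rw [lintegral_map ((continuous_fst.edist continuous_snd).measurable.pow_const p)
      hfg.measurable]
  refine ⟨?_, ?_, ?_, ?_⟩
  · exact Measure.isProbabilityMeasure_map hfg.measurable.aemeasurable
  · exact hπ.map hfg hfg.measurable
  · intro B hB
    have : MeasurableSet (B ×ˢ (univ : Set M)) := by
      rw [prod_univ]; exact continuous_fst.measurable hB
    rw [Measure.map_apply hfg.measurable this, Measure.map_apply hf.measurable hB]
    congr 1
    ext; simp
  · intro B hB
    have : MeasurableSet ((univ : Set M) ×ˢ B) := by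
      rw [univ_prod]; exact continuous_snd.measurable hB
    rw [Measure.map_apply hfg.measurable this, Measure.map_apply hg.measurable hB]
    congr 1
    ext; simp

/-- Every coupling has the stated form, with `X = M × M` and the two projections. -/
lemma le_wassersteinDist.{u} {M : Type u} [MetricSpace M] [MeasurableSpace M] [BorelSpace M]
    {p : ℝ} (hp : 0 < p) {μ ν : Measure M} {c : ℝ≥0∞}
    (h : ∀ (X : Type u) [TopologicalSpace X] [MeasurableSpace X] [BorelSpace X] (π : Measure X)
      [IsProbabilityMeasure π] (f g : X → M), HasFullSupport π → Continuous f → Continuous g →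
      π.map f = μ → π.map g = ν → c ^ p ≤ ∫⁻ x, edist (f x) (g x) ^ p ∂π) :
    c ≤ wassersteinDist p μ ν := by
  let _ : MeasurableSpace (M × M) := borel (M × M)
  have : BorelSpace (M × M) := ⟨rfl⟩
  rw [wassersteinDist, one_div, ENNReal.le_rpow_inv_iff hp]
  refine le_iInf₂ fun π hπ => ?_
  obtain ⟨h1, h2, h3, h4⟩ := hπ
  refine h (M × M) π Prod.fst Prod.snd h2 continuous_fst continuous_snd ?_ ?_
  · ext B hB
    rw [Measure.map_apply continuous_fst.measurable hB, ← h3 B hB, prod_univ]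
  · ext B hB
    rw [Measure.map_apply continuous_snd.measurable hB, ← h4 B hB, univ_prod]

/-- A contractive barycentric map is controlled by every pair of maps realizing a coupling. -/
lemma ContractiveBary.edist_rpow_le {X : Type*} [TopologicalSpace X] [MeasurableSpace X]
    [OpensMeasurableSpace X] {p : ℝ} (hp : 0 < p) (β : ContractiveBary p M) (π : Measure X)
    [IsProbabilityMeasure π] (hπ : HasFullSupport π) {f g : X → M} (hf : Continuous f)
    (hg : Continuous g) {μ ν : ProbP p M} (hμ : μ.1 = π.map f) (hν : ν.1 = π.map g) :
    edist (β.1 μ) (β.1 ν) ^ p ≤ ∫⁻ x, edist (f x) (g x) ^ p ∂π := by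
  rw [← ENNReal.le_rpow_inv_iff hp, ← one_div]
  refine (β.2.contractive μ ν).trans ?_
  rw [hμ, hν]
  exact wassersteinDist_map_le hp.le π hπ hf hg

/-! ### Geodesic push-forwards, fixed points and the semiflow -/

lemma IsProbPMoment.lintegral_lt_top {p : ℝ} (hp : 1 ≤ p) {μ : Measure M}
    (h : IsProbPMoment p μ) (x : M) : ∫⁻ y, edist x y ^ p ∂μ < ∞ := by
  have := h.isProb
  obtain ⟨x₀, hx₀⟩ := h.moment
  have h1 : ∀ y, edist x y ^ p ≤ 2 ^ (p - 1) * (edist x x₀ ^ p + edist x₀ y ^ p) := fun y =>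
    (ENNReal.rpow_le_rpow (edist_triangle x x₀ y) (by linarith)).trans
      (ENNReal.rpow_add_le_mul_rpow_add_rpow _ _ hp)
  refine (lintegral_mono h1).trans_lt ?_
  rw [lintegral_const_mul' _ _ (by finiteness), lintegral_add_left measurable_const,
    lintegral_const, measure_univ, mul_one]
  refine ENNReal.mul_lt_top (by finiteness) (ENNReal.add_lt_top.2 ⟨?_, hx₀⟩)
  exact ENNReal.rpow_lt_top_of_nonneg (by linarith) (edist_ne_top _ _)

lemma IsGlobalNPC.isProbPMoment_geodMeasure (hM : IsGlobalNPC M) {p : ℝ} (hp : 1 ≤ p) (x : M)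
    {t : ℝ} (ht : t ∈ Icc (0 : ℝ) 1) (μ : ProbP p M) :
    IsProbPMoment p (geodMeasure x t μ.1) := by
  have := μ.2.isProb
  have hc := hM.continuous_geodPoint x ht
  refine ⟨Measure.isProbabilityMeasure_map hc.measurable.aemeasurable,
    μ.2.fullSupport.map hc hc.measurable, x, ?_⟩
  unfold geodMeasure
  have hm : Measurable fun y : M => edist x y ^ p :=
    (continuous_const.edist continuous_id).measurable.pow_const p
  rw [lintegral_map hm hc.measurable]
  refine (lintegral_mono fun a => ?_).trans_lt (μ.2.lintegral_lt_top hp x)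
  refine ENNReal.rpow_le_rpow ?_ (by linarith)
  rw [edist_dist, edist_dist, hM.dist_left_geodPoint x a ht]
  exact ENNReal.ofReal_le_ofReal (mul_le_of_le_one_left dist_nonneg ht.2)

/-- `x #_t μ` as an element of `𝒫^p(M)`. -/
noncomputable def IsGlobalNPC.geodP (hM : IsGlobalNPC M) {p : ℝ} (hp : 1 ≤ p) (x : M)
    (t : Ioc (0 : ℝ) 1) (μ : ProbP p M) : ProbP p M :=
  ⟨geodMeasure x t μ.1, hM.isProbPMoment_geodMeasure hp x (Ioc_subset_Icc_self t.2) μ⟩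

lemma ContractiveBary.congr {p : ℝ} (β : ContractiveBary p M) {μ ν : ProbP p M}
    (h : μ.1 = ν.1) : β.1 μ = β.1 ν := congrArg β.1 (Subtype.ext h)

lemma IsGlobalNPC.dist_bary_geodP_le (hM : IsGlobalNPC M) {p : ℝ} (hp : 1 ≤ p)
    (β : ContractiveBary p M) (t : Ioc (0 : ℝ) 1) (μ : ProbP p M) (x y : M) :
    dist (β.1 (hM.geodP hp x t μ)) (β.1 (hM.geodP hp y t μ)) ≤ (1 - t) * dist x y := by
  have ht := Ioc_subset_Icc_self t.2
  have := μ.2.isProb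
  have h := β.edist_rpow_le (by linarith) μ.1 μ.2.fullSupport (hM.continuous_geodPoint x ht)
    (hM.continuous_geodPoint y ht) (μ := hM.geodP hp x t μ) (ν := hM.geodP hp y t μ) rfl rfl
  have h2 : ∀ a, edist (geodPoint x t a) (geodPoint y t a) ^ p
      ≤ ENNReal.ofReal ((1 - t) * dist x y) ^ p := fun a => by
    refine ENNReal.rpow_le_rpow ?_ (by linarith)
    rw [edist_dist]
    refine ENNReal.ofReal_le_ofReal ?_
    have := hM.dist_geodPoint_le x y a a ht
    rwa [dist_self, mul_zero, add_zero] at this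
  have h3 := h.trans (lintegral_mono h2)
  rw [lintegral_const, measure_univ, mul_one, ENNReal.rpow_le_rpow_iff (by linarith),
    edist_dist] at h3
  exact (ENNReal.ofReal_le_ofReal_iff
    (mul_nonneg (by linarith [ht.2]) dist_nonneg)).1 h3

lemma IsGlobalNPC.existsUnique_fixed (hM : IsGlobalNPC M) {p : ℝ} (hp : 1 ≤ p)
    (β : ContractiveBary p M) (t : Ioc (0 : ℝ) 1) (μ : ProbP p M) :
    ∃! x, x = β.1 (hM.geodP hp x t μ) := by
  have := hM.complete
  have ht0 := t.2.1
  have ht1 : (0 : ℝ) ≤ 1 - t := sub_nonneg.2 t.2.2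
  have hne : Nonempty M := by
    obtain ⟨x, -⟩ := μ.2.moment
    exact ⟨x⟩
  set T : M → M := fun x => β.1 (hM.geodP hp x t μ)
  have hT : ContractingWith ⟨1 - t, ht1⟩ T :=
    ⟨show (1 : ℝ) - t < 1 by linarith,
      LipschitzWith.of_dist_le_mul fun x y => hM.dist_bary_geodP_le hp β t μ x y⟩
  refine ⟨ContractingWith.fixedPoint T hT, hT.fixedPoint_isFixedPt.symm, fun y hy => ?_⟩
  exact hT.fixedPoint_unique (Function.IsFixedPt.eq hy.symm)

lemma IsGlobalNPC.edist_geodPoint_rpow_le (hM : IsGlobalNPC M) {p : ℝ} (hp : 1 ≤ p)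
    (x y a b : M) {t : ℝ} (ht : t ∈ Icc (0 : ℝ) 1) :
    edist (geodPoint x t a) (geodPoint y t b) ^ p ≤
      ENNReal.ofReal (1 - t) * edist x y ^ p + ENNReal.ofReal t * edist a b ^ p := by
  have ht2 : 0 ≤ 1 - t := by linarith [ht.2]
  have hp0 : 0 ≤ p := by linarith
  simp only [edist_dist]
  rw [ENNReal.ofReal_rpow_of_nonneg dist_nonneg hp0, ENNReal.ofReal_rpow_of_nonneg dist_nonneg hp0,
    ENNReal.ofReal_rpow_of_nonneg dist_nonneg hp0, ← ENNReal.ofReal_mul ht2,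
    ← ENNReal.ofReal_mul ht.1, ← ENNReal.ofReal_add (by positivity)
      (mul_nonneg ht.1 (by positivity))]
  refine ENNReal.ofReal_le_ofReal ?_
  refine (Real.rpow_le_rpow dist_nonneg (hM.dist_geodPoint_le x y a b ht) hp0).trans ?_
  exact (convexOn_rpow hp).2 (mem_Ici.2 dist_nonneg) (mem_Ici.2 dist_nonneg) ht2 ht.1 (by ring)

/-- The barycentric map `Φ_p(t, β)`: its value at `μ` is the fixed point of
`x ↦ β(x #_t μ)`. -/
noncomputable def IsGlobalNPC.flow (hM : IsGlobalNPC M) {p : ℝ} (hp : 1 ≤ p)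
    (t : Ioc (0 : ℝ) 1) (β : ContractiveBary p M) : ContractiveBary p M :=
  ⟨fun μ => (hM.existsUnique_fixed hp β t μ).choose, by
    have ht := Ioc_subset_Icc_self t.2
    have hp0 : 0 < p := by linarith
    constructor
    · intro x μ hμ
      refine ((hM.existsUnique_fixed hp β t μ).choose_spec.2 x ?_).symm
      refine (β.2.map_dirac x _ ?_).symm
      change geodMeasure x t μ.1 = _
      rw [hμ, geodMeasure, Measure.map_dirac' (hM.continuous_geodPoint x ht).measurable,
        ← hM.eq_geodPoint ht (v := x) (by simp) (by simp)]
    · intro μ ν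
      refine le_wassersteinDist hp0 fun X _ _ _ π _ f g hπ hf hg hμ hν => ?_
      set x := (hM.existsUnique_fixed hp β t μ).choose
      set y := (hM.existsUnique_fixed hp β t ν).choose
      have hx : x = _ := (hM.existsUnique_fixed hp β t μ).choose_spec.1
      have hy : y = _ := (hM.existsUnique_fixed hp β t ν).choose_spec.1
      have hcx := hM.continuous_geodPoint x ht
      have hcy := hM.continuous_geodPoint y ht
      have h1 := β.edist_rpow_le hp0 π hπ (hcx.comp hf) (hcy.comp hg)
        (μ := hM.geodP hp x t μ) (ν := hM.geodP hp y t ν)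
        (by change geodMeasure x t μ.1 = _
            rw [geodMeasure, ← hμ, Measure.map_map hcx.measurable hf.measurable])
        (by change geodMeasure y t ν.1 = _
            rw [geodMeasure, ← hν, Measure.map_map hcy.measurable hg.measurable])
      rw [← hx, ← hy] at h1
      have h2 := h1.trans (lintegral_mono fun a =>
        hM.edist_geodPoint_rpow_le hp x y (f a) (g a) ht)
      rw [lintegral_add_left measurable_const, lintegral_const, measure_univ, mul_one,
        lintegral_const_mul' _ _ ENNReal.ofReal_ne_top] at h2
      have hfin : edist x y ^ p ≠ ∞ :=
        (ENNReal.rpow_lt_top_of_nonneg hp0.le (edist_ne_top _ _)).ne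
      -- The term `(1-t) d(x,y)^p` is finite and appears on both sides; removing it leaves a common
      -- factor `t > 0`.
      have hsplit : edist x y ^ p = ENNReal.ofReal (1 - t) * edist x y ^ p
          + ENNReal.ofReal t * edist x y ^ p := by
        rw [← add_mul, ← ENNReal.ofReal_add (by linarith [ht.2]) ht.1, sub_add_cancel,
          ENNReal.ofReal_one, one_mul]
      nth_rw 1 [hsplit] at h2
      have h3 := (ENNReal.add_le_add_iff_left (ENNReal.mul_ne_top ENNReal.ofReal_ne_top hfin)).1 h2
      exact (ENNReal.mul_le_mul_iff_right (ENNReal.ofReal_pos.2 t.2.1).ne'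
        ENNReal.ofReal_ne_top).1 h3⟩

lemma IsGlobalNPC.flow_spec (hM : IsGlobalNPC M) {p : ℝ} (hp : 1 ≤ p)
    (t : Ioc (0 : ℝ) 1) (β : ContractiveBary p M) (μ : ProbP p M) (x : M) :
    x = (hM.flow hp t β).1 μ ↔ x = β.1 (hM.geodP hp x t μ) := by
  obtain ⟨h1, h2⟩ := (hM.existsUnique_fixed hp β t μ).choose_spec
  constructor
  · rintro rfl
    exact h1
  · exact h2 x

lemma IsGlobalNPC.flow_one (hM : IsGlobalNPC M) {p : ℝ} (hp : 1 ≤ p) (β : ContractiveBary p M) :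
    hM.flow hp 1 β = β := by
  refine Subtype.ext (funext fun μ => ((hM.flow_spec hp 1 β μ _).2 ?_).symm)
  refine β.congr ?_
  change μ.1 = geodMeasure _ 1 μ.1
  simp only [geodMeasure, hM.geodPoint_one, Measure.map_id']

lemma IsGlobalNPC.flow_flow (hM : IsGlobalNPC M) {p : ℝ} (hp : 1 ≤ p) (s t : Ioc (0 : ℝ) 1)
    (β : ContractiveBary p M) : hM.flow hp t (hM.flow hp s β) = hM.flow hp (t * s) β := by
  refine Subtype.ext (funext fun μ => ?_)
  have ht := Ioc_subset_Icc_self t.2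
  have hs := Ioc_subset_Icc_self s.2
  set x := (hM.flow hp (t * s) β).1 μ with hxdef
  have hx := (hM.flow_spec hp (t * s) β μ x).1 hxdef
  -- Two uses of the fixed-point characterization reduce the claim to `x = β(x #_s (x #_t μ))`.
  refine ((hM.flow_spec hp t _ μ x).2 ((hM.flow_spec hp s β _ x).2 (hx.trans ?_))).symm
  refine β.congr ?_
  change geodMeasure x ((t * s : Ioc (0 : ℝ) 1) : ℝ) μ.1 = geodMeasure x s (geodMeasure x t μ.1)
  simp only [geodMeasure]
  rw [Measure.map_map (hM.continuous_geodPoint x hs).measurable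
    (hM.continuous_geodPoint x ht).measurable]
  congr 1
  funext a
  exact (hM.geodPoint_geodPoint x a hs ht).symm

end Measures

/-! ### Uniform measures -/

section Uniform

/-- The arithmetic mean of a finite family. -/
noncomputable def finAvg {n : ℕ} (f : Fin (n + 1) → ℝ) : ℝ := (∑ j, f j) / (n + 1)

lemma finAvg_mono {n : ℕ} {f g : Fin (n + 1) → ℝ} (h : ∀ j, f j ≤ g j) : finAvg f ≤ finAvg g := by
  unfold finAvg
  gcongr with j
  exact h j

lemma finAvg_const {n : ℕ} (c : ℝ) : finAvg (fun _ : Fin (n + 1) => c) = c := by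
  simp only [finAvg, Finset.sum_const, Finset.card_univ, Fintype.card_fin, nsmul_eq_mul]
  push_cast
  have : (n : ℝ) + 1 ≠ 0 := by positivity
  field_simp

lemma finAvg_combo {n : ℕ} (a b c : ℝ) (f g : Fin (n + 1) → ℝ) :
    finAvg (fun j => a + b * f j - c * g j) = a + b * finAvg f - c * finAvg g := by
  have h := finAvg_const (n := n) a
  simp only [finAvg] at h ⊢
  rw [Finset.sum_sub_distrib, Finset.sum_add_distrib, ← Finset.mul_sum, ← Finset.mul_sum,
    sub_div, add_div, h]
  ring

lemma sq_finAvg_le {n : ℕ} (f : Fin (n + 1) → ℝ) : finAvg f ^ 2 ≤ finAvg fun j => f j ^ 2 := by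
  have h := sq_sum_le_card_mul_sum_sq (s := Finset.univ) (f := f)
  simp only [Finset.card_univ, Fintype.card_fin] at h
  push_cast at h
  have hn : (0 : ℝ) < n + 1 := by positivity
  unfold finAvg
  rw [div_pow, div_le_div_iff₀ (by positivity) hn]
  nlinarith

variable {M : Type*} [MetricSpace M] [MeasurableSpace M] [BorelSpace M]

lemma uniformOn_map {X Y : Type*} [MeasurableSpace X] [MeasurableSpace Y] {n : ℕ}
    (x : Fin (n + 1) → X) {f : X → Y} (hf : Measurable f) :
    (uniformOn x).map f = uniformOn (f ∘ x) := by
  have hsum : ∀ s : Finset (Fin (n + 1)), (∑ j ∈ s, Measure.dirac (x j)).map f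
      = ∑ j ∈ s, Measure.dirac (f (x j)) := fun s => by
    classical
    induction s using Finset.induction_on with
    | empty => simp
    | insert a s ha ih =>
      rw [Finset.sum_insert ha, Finset.sum_insert ha, Measure.map_add _ _ hf, ih,
        Measure.map_dirac' hf]
  simp only [uniformOn, Measure.map_smul, hsum, Function.comp]

lemma uniformOn_const {X : Type*} [MeasurableSpace X] {n : ℕ} (z : X) :
    uniformOn (fun _ : Fin (n + 1) => z) = Measure.dirac z := by
  have hn : ((n + 1 : ℕ) : ℝ≥0∞) ≠ 0 := by exact_mod_cast Nat.succ_ne_zero n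
  simp only [uniformOn, Finset.sum_const, Finset.card_univ, Fintype.card_fin]
  rw [← Nat.cast_smul_eq_nsmul ℝ≥0∞, smul_smul,
    ENNReal.inv_mul_cancel hn (ENNReal.natCast_ne_top _), one_smul]

lemma lintegral_uniformOn_ofReal {X : Type*} [MeasurableSpace X] {n : ℕ}
    (x : Fin (n + 1) → X) {f : X → ℝ} (hf : Measurable f) (h0 : ∀ a, 0 ≤ f a) :
    ∫⁻ a, ENNReal.ofReal (f a) ∂(uniformOn x) = ENNReal.ofReal (finAvg (f ∘ x)) := by
  have hn : (0 : ℝ) < n + 1 := by positivity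
  simp only [uniformOn, lintegral_smul_measure, lintegral_finsetSum_measure,
    lintegral_dirac' _ hf.ennreal_ofReal, smul_eq_mul, finAvg, Function.comp]
  rw [← ENNReal.ofReal_sum_of_nonneg fun j _ => h0 _, div_eq_inv_mul,
    ENNReal.ofReal_mul (by positivity), ENNReal.ofReal_inv_of_pos hn]
  congr 2
  rw [← ENNReal.ofReal_natCast]
  push_cast
  rfl

/-- `p`-contractivity on uniform measures. -/
lemma ContractiveBary.dist_uniformOn_le {p : ℝ} (hp : 0 < p) (β : ContractiveBary p M) {n : ℕ}
    (u v : Fin (n + 1) → M) (hu : IsProbPMoment p (uniformOn u))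
    (hv : IsProbPMoment p (uniformOn v)) :
    dist (β.1 ⟨uniformOn u, hu⟩) (β.1 ⟨uniformOn v, hv⟩) ^ p
      ≤ finAvg fun j => dist (u j) (v j) ^ p := by
  -- The coupling lives on the index set with its uniform measure: the `j`-th atom is carried to the
  -- `j`-th atom.
  have hprob : IsProbabilityMeasure (uniformOn (id : Fin (n + 1) → Fin (n + 1))) := by
    have hn : ((n + 1 : ℕ) : ℝ≥0∞) ≠ 0 := by exact_mod_cast Nat.succ_ne_zero n
    constructor
    simp only [uniformOn, Measure.smul_apply, Measure.finsetSum_apply, measure_univ,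
      Finset.sum_const, Finset.card_univ, Fintype.card_fin, smul_eq_mul, nsmul_eq_mul, mul_one]
    exact ENNReal.inv_mul_cancel hn (ENNReal.natCast_ne_top _)
  have hsupp : HasFullSupport (uniformOn (id : Fin (n + 1) → Fin (n + 1))) := by
    have : (uniformOn (id : Fin (n + 1) → Fin (n + 1))).support = univ := by
      refine eq_univ_of_forall fun j => ?_
      rw [Measure.mem_support_iff_forall]
      intro U hU
      have h1 : Measure.dirac j U = 1 := Measure.dirac_apply_of_mem (mem_of_mem_nhds hU)
      have h2 : (1 : ℝ≥0∞) ≤ ∑ i : Fin (n + 1), Measure.dirac i U := by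
        rw [← h1]
        exact Finset.single_le_sum (f := fun i : Fin (n + 1) => Measure.dirac i U)
          (fun _ _ => zero_le) (Finset.mem_univ j)
      simp only [uniformOn, Measure.smul_apply, Measure.finsetSum_apply, smul_eq_mul, id]
      exact ENNReal.mul_pos (ENNReal.inv_ne_zero.2 (ENNReal.natCast_ne_top _))
        (zero_lt_one.trans_le h2).ne'
    rw [HasFullSupport, this, compl_univ, measure_empty]
  have h := β.edist_rpow_le hp (uniformOn (id : Fin (n + 1) → Fin (n + 1))) hsupp
    (continuous_of_discreteTopology (f := u)) (continuous_of_discreteTopology (f := v))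
    (μ := ⟨uniformOn u, hu⟩) (ν := ⟨uniformOn v, hv⟩)
    (uniformOn_map _ (measurable_of_countable u)).symm
    (uniformOn_map _ (measurable_of_countable v)).symm
  simp only [edist_dist, ENNReal.ofReal_rpow_of_nonneg dist_nonneg hp.le] at h
  rw [lintegral_uniformOn_ofReal _ (measurable_of_countable _) fun _ => by positivity] at h
  refine (ENNReal.ofReal_le_ofReal_iff ?_).1 h
  unfold finAvg
  positivity

lemma ContractiveBary.uniformOn_const {p : ℝ} (β : ContractiveBary p M) {n : ℕ} (z : M)
    (hz : IsProbPMoment p (uniformOn fun _ : Fin (n + 1) => z)) :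
    β.1 ⟨uniformOn fun _ : Fin (n + 1) => z, hz⟩ = z :=
  β.2.map_dirac z _ (_root_.uniformOn_const z)

lemma ContractiveBary.dist_uniformOn_right_le {p : ℝ} (hp : 0 < p) (β : ContractiveBary p M)
    {n : ℕ} (u : Fin (n + 1) → M) (hu : IsProbPMoment p (uniformOn u)) (z : M) :
    dist z (β.1 ⟨uniformOn u, hu⟩) ^ p ≤ finAvg fun j => dist z (u j) ^ p := by
  have h := β.dist_uniformOn_le hp (fun _ => z) u (uniformOn_isProbPMoment hp.le _) hu
  rwa [β.uniformOn_const] at h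

lemma dist_le_diam_range {n : ℕ} (x : Fin (n + 1) → M) (i j : Fin (n + 1)) :
    dist (x i) (x j) ≤ Metric.diam (range x) :=
  Metric.dist_le_diam_of_mem (finite_range x).isBounded (mem_range_self i) (mem_range_self j)

/-- The value of a contractive barycentric map is within the diameter of the points. -/
lemma ContractiveBary.dist_le_diam {p : ℝ} (hp : 0 < p) (β : ContractiveBary p M)
    {n : ℕ} (x : Fin (n + 1) → M) (hx : IsProbPMoment p (uniformOn x)) (i : Fin (n + 1)) :
    dist (β.1 ⟨uniformOn x, hx⟩) (x i) ≤ Metric.diam (range x) := by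
  have h := β.dist_uniformOn_right_le hp x hx (x i)
  have h2 : finAvg (fun j => dist (x i) (x j) ^ p) ≤ Metric.diam (range x) ^ p := by
    rw [← finAvg_const (n := n) (Metric.diam (range x) ^ p)]
    exact finAvg_mono fun j =>
      Real.rpow_le_rpow dist_nonneg (dist_le_diam_range x i j) hp.le
  rw [dist_comm]
  exact (Real.rpow_le_rpow_iff dist_nonneg Metric.diam_nonneg hp).1 (h.trans h2)

lemma ContractiveBary.edist_le_ofReal {p : ℝ} (β₁ β₂ : ContractiveBary p M) {C : ℝ} (hC : 0 ≤ C)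
    (h : ∀ (n : ℕ) (x : Fin (n + 1) → M) (hx : IsProbPMoment p (uniformOn x)),
      0 < Metric.diam (range x) →
      dist (β₁.1 ⟨uniformOn x, hx⟩) (β₂.1 ⟨uniformOn x, hx⟩) ≤ C * Metric.diam (range x)) :
    edist β₁ β₂ ≤ ENNReal.ofReal C := by
  refine iSup_le fun n => iSup_le fun x => iSup_le fun hx => iSup_le fun hd => ?_
  refine ENNReal.div_le_of_le_mul ?_
  rw [← ENNReal.ofReal_mul hC, edist_dist]
  exact ENNReal.ofReal_le_ofReal (h n x hx (lt_of_le_of_ne Metric.diam_nonneg hd.symm))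

lemma ContractiveBary.dist_le_of_edist_le {p : ℝ} (hp : 0 < p) {β₁ β₂ : ContractiveBary p M}
    {C : ℝ} (hC : 0 ≤ C) (h : edist β₁ β₂ ≤ ENNReal.ofReal C) {n : ℕ} (x : Fin (n + 1) → M)
    (hx : IsProbPMoment p (uniformOn x)) :
    dist (β₁.1 ⟨uniformOn x, hx⟩) (β₂.1 ⟨uniformOn x, hx⟩) ≤ C * Metric.diam (range x) := by
  rcases eq_or_ne (Metric.diam (range x)) 0 with hd | hd
  · have h1 := β₁.dist_le_diam hp x hx 0
    have h2 := β₂.dist_le_diam hp x hx 0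
    have h3 := dist_triangle_right (β₁.1 ⟨uniformOn x, hx⟩) (β₂.1 ⟨uniformOn x, hx⟩) (x 0)
    rw [hd] at h1 h2 ⊢
    linarith
  · have hd' : 0 < Metric.diam (range x) := lt_of_le_of_ne Metric.diam_nonneg hd.symm
    have h1 : edist (β₁.1 ⟨uniformOn x, hx⟩) (β₂.1 ⟨uniformOn x, hx⟩)
        / ENNReal.ofReal (Metric.diam (range x)) ≤ edist β₁ β₂ :=
      le_iSup_of_le n (le_iSup_of_le x (le_iSup_of_le hx (le_iSup_of_le hd le_rfl)))
    have h2 := h1.trans h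
    rw [ENNReal.div_le_iff (ENNReal.ofReal_pos.2 hd').ne' ENNReal.ofReal_ne_top,
      ← ENNReal.ofReal_mul hC, edist_dist] at h2
    exact (ENNReal.ofReal_le_ofReal_iff (by positivity)).1 h2

end Uniform

/-! ### The flow on uniform measures -/

section Flow

variable {M : Type*} [MetricSpace M] [MeasurableSpace M] [BorelSpace M]

lemma IsGlobalNPC.flow_uniformOn (hM : IsGlobalNPC M) {p : ℝ} (hp : 1 ≤ p) (t : Ioc (0 : ℝ) 1)
    (β : ContractiveBary p M) {n : ℕ} (x : Fin (n + 1) → M) (hx : IsProbPMoment p (uniformOn x))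
    {y : M} (hy : y = (hM.flow hp t β).1 ⟨uniformOn x, hx⟩)
    (h : IsProbPMoment p (uniformOn fun j => geodPoint y t (x j))) :
    y = β.1 ⟨uniformOn fun j => geodPoint y t (x j), h⟩ := by
  refine ((hM.flow_spec hp t β _ y).1 hy).trans (β.congr ?_)
  exact uniformOn_map x (hM.continuous_geodPoint y (Ioc_subset_Icc_self t.2)).measurable

/-- The variance inequality for `Φ_p(s, β)` on uniform measures. -/
lemma IsGlobalNPC.variance_flow (hM : IsGlobalNPC M) {p : ℝ} (hp : 1 ≤ p) (s : Ioc (0 : ℝ) 1)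
    (β : ContractiveBary p M) {n : ℕ} (x : Fin (n + 1) → M) (hx : IsProbPMoment p (uniformOn x))
    (z : M) : dist z ((hM.flow hp s β).1 ⟨uniformOn x, hx⟩) ^ (2 * p) ≤
      finAvg (fun j => dist z (x j) ^ (2 * p)) - convexityConst (2 * p) / 2 * (1 - s) *
        finAvg (fun j => dist ((hM.flow hp s β).1 ⟨uniformOn x, hx⟩) (x j) ^ (2 * p)) := by
  set y := (hM.flow hp s β).1 ⟨uniformOn x, hx⟩ with hydef
  have hp0 : 0 < p := by linarith
  have h1 := hM.flow_uniformOn hp s β x hx hydef (uniformOn_isProbPMoment hp0.le _)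
  have h2 := β.dist_uniformOn_right_le hp0 (fun j => geodPoint y s (x j))
    (uniformOn_isProbPMoment hp0.le _) z
  rw [← h1] at h2
  have hsq : ∀ a b : M, (dist a b ^ p) ^ 2 = dist a b ^ (2 * p) := fun a b => by
    rw [← Real.rpow_natCast, ← Real.rpow_mul dist_nonneg, mul_comm]
    norm_cast
  have h3 := (pow_le_pow_left₀ (by positivity) h2 2).trans (sq_finAvg_le _)
  simp only [hsq] at h3
  -- The geodesics issue from `y` itself, so the bound contains `(1-s) d(z,y)^{2p}`; absorbing it
  -- leaves a factor `s`, which is then divided out.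
  have h4 := h3.trans (finAvg_mono fun j =>
    hM.uniform_convexity (by linarith : 2 ≤ 2 * p) (Ioc_subset_Icc_self s.2) y (x j) z)
  rw [finAvg_combo] at h4
  have hs := s.2.1
  have h5 : (s : ℝ) * dist z y ^ (2 * p) ≤ s * (finAvg (fun j => dist z (x j) ^ (2 * p))
      - convexityConst (2 * p) / 2 * (1 - s) * finAvg (fun j => dist y (x j) ^ (2 * p))) := by
    linarith
  exact le_of_mul_le_mul_left h5 hs

lemma finAvg_dist_rpow_le_diam {p q : ℝ} (hp : 0 < p) (hq : 0 ≤ q) (β : ContractiveBary p M)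
    {n : ℕ} (x : Fin (n + 1) → M) (hx : IsProbPMoment p (uniformOn x)) :
    finAvg (fun j => dist (β.1 ⟨uniformOn x, hx⟩) (x j) ^ q) ≤ Metric.diam (range x) ^ q := by
  rw [← finAvg_const (n := n) (Metric.diam (range x) ^ q)]
  exact finAvg_mono fun j => Real.rpow_le_rpow dist_nonneg (β.dist_le_diam hp x hx j) hq

/-- The Hölder estimate for the flow. -/
lemma IsGlobalNPC.edist_flow_flow_le (hM : IsGlobalNPC M) {p : ℝ} (hp : 1 ≤ p)
    (t s : Ioc (0 : ℝ) 1) (β : ContractiveBary p M) :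
    edist (hM.flow hp t β) (hM.flow hp s β) ≤ ENNReal.ofReal
      (((convexityConst (2 * p) * ((s : ℝ) + t) + 2 * (2 - convexityConst (2 * p))) / 4)
        ^ (1 / (2 * p))) := by
  have hp0 : 0 < p := by linarith
  have hq : 0 < 2 * p := by linarith
  have hk0 := convexityConst_nonneg (show 2 ≤ 2 * p by linarith)
  have hk2 := convexityConst_le_two (show 2 ≤ 2 * p by linarith)
  set k := convexityConst (2 * p)
  obtain ⟨ht0, ht1⟩ := t.2
  obtain ⟨hs0, hs1⟩ := s.2
  have hE : 0 ≤ (k * ((s : ℝ) + t) + 2 * (2 - k)) / 4 := by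
    have := mul_nonneg hk0 (add_nonneg hs0.le ht0.le)
    linarith
  refine ContractiveBary.edist_le_ofReal _ _ (by positivity) fun n x hx _ => ?_
  set u := (hM.flow hp t β).1 ⟨uniformOn x, hx⟩ with hu
  set v := (hM.flow hp s β).1 ⟨uniformOn x, hx⟩ with hv
  have h1 := hM.variance_flow hp s β x hx u
  have h2 := hM.variance_flow hp t β x hx v
  rw [← hv] at h1
  rw [← hu, dist_comm v u] at h2
  have h3 := finAvg_dist_rpow_le_diam hp0 hq.le (hM.flow hp t β) x hx
  have h4 := finAvg_dist_rpow_le_diam hp0 hq.le (hM.flow hp s β) x hx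
  rw [← hu] at h3
  rw [← hv] at h4
  have hΔ : 0 ≤ Metric.diam (range x) := Metric.diam_nonneg
  set Δ := Metric.diam (range x)
  -- Adding `h1` and `h2` leaves the two averages with these coefficients. They are nonnegative
  -- because `k ≤ 2`, so each average may be replaced by its bound `Δ^{2p}`.
  have c1 : 0 ≤ 1 - k / 2 * (1 - t) := by nlinarith
  have c2 : 0 ≤ 1 - k / 2 * (1 - s) := by nlinarith
  have h5 := mul_le_mul_of_nonneg_left h3 c1
  have h6 := mul_le_mul_of_nonneg_left h4 c2
  have h7 : dist u v ^ (2 * p) ≤ (k * ((s : ℝ) + t) + 2 * (2 - k)) / 4 * Δ ^ (2 * p) := by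
    linarith
  have h8 := Real.rpow_le_rpow (by positivity) h7 (show 0 ≤ 1 / (2 * p) by positivity)
  rwa [Real.mul_rpow hE (by positivity), ← Real.rpow_mul dist_nonneg, ← Real.rpow_mul hΔ,
    mul_one_div_cancel hq.ne', Real.rpow_one, Real.rpow_one] at h8

lemma diam_geodPoint_le (hM : IsGlobalNPC M) (y : M) {t : ℝ} (ht : t ∈ Icc (0 : ℝ) 1) {n : ℕ}
    (x : Fin (n + 1) → M) :
    Metric.diam (range fun j => geodPoint y t (x j)) ≤ t * Metric.diam (range x) := by
  refine Metric.diam_le_of_forall_dist_le (mul_nonneg ht.1 Metric.diam_nonneg) ?_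
  rintro _ ⟨i, rfl⟩ _ ⟨j, rfl⟩
  exact (hM.dist_geodPoint_right_le y _ _ ht).trans
    (mul_le_mul_of_nonneg_left (dist_le_diam_range x i j) ht.1)

/-- `Φ_p(t, ·)` is nonexpansive. -/
lemma IsGlobalNPC.edist_flow_le (hM : IsGlobalNPC M) {p : ℝ} (hp : 1 ≤ p)
    (t : Ioc (0 : ℝ) 1) (β β' : ContractiveBary p M) :
    edist (hM.flow hp t β) (hM.flow hp t β') ≤ edist β β' := by
  have hp0 : 0 < p := by linarith
  have ht := Ioc_subset_Icc_self t.2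
  rcases eq_or_ne (edist β β') ∞ with htop | htop
  · rw [htop]; exact le_top
  rw [← ENNReal.ofReal_toReal htop]
  set C := (edist β β').toReal
  have hC : 0 ≤ C := ENNReal.toReal_nonneg
  refine ContractiveBary.edist_le_ofReal _ _ hC fun n x hx _ => ?_
  set u := (hM.flow hp t β).1 ⟨uniformOn x, hx⟩ with hu
  set v := (hM.flow hp t β').1 ⟨uniformOn x, hx⟩ with hv
  have h1 := hM.flow_uniformOn hp t β x hx hu (uniformOn_isProbPMoment hp0.le _)
  have h2 := hM.flow_uniformOn hp t β' x hx hv (uniformOn_isProbPMoment hp0.le _)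
  have h3 := ContractiveBary.dist_le_of_edist_le hp0 hC
    (ENNReal.ofReal_toReal htop).ge (fun j => geodPoint v t (x j))
    (uniformOn_isProbPMoment hp0.le _)
  rw [← h2] at h3
  have h4 := β.dist_uniformOn_le hp0 (fun j => geodPoint u t (x j))
    (fun j => geodPoint v t (x j)) (uniformOn_isProbPMoment hp0.le _)
    (uniformOn_isProbPMoment hp0.le _)
  rw [← h1] at h4
  have h5 : finAvg (fun j => dist (geodPoint u t (x j)) (geodPoint v t (x j)) ^ p)
      ≤ ((1 - t) * dist u v) ^ p := by
    rw [← finAvg_const (n := n) (((1 - t) * dist u v) ^ p)]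
    refine finAvg_mono fun j => Real.rpow_le_rpow dist_nonneg ?_ hp0.le
    have := hM.dist_geodPoint_le u v (x j) (x j) ht
    rwa [dist_self, mul_zero, add_zero] at this
  have h6 := (Real.rpow_le_rpow_iff dist_nonneg
    (mul_nonneg (by linarith [ht.2]) dist_nonneg) hp0).1 (h4.trans h5)
  have h7 := h3.trans (mul_le_mul_of_nonneg_left (diam_geodPoint_le hM v ht x) hC)
  -- The intermediate point applies `β` to the family contracted towards `v`: from `u` it differs by
  -- at most `(1-t) d(u,v)`, and from `v` by `C` times a diameter already shrunk by `t`. Absorption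
  -- then cancels `t`.
  have h8 := dist_triangle u
    (β.1 ⟨uniformOn fun j => geodPoint v t (x j), uniformOn_isProbPMoment hp0.le _⟩) v
  have h9 : (t : ℝ) * dist u v ≤ t * (C * Metric.diam (range x)) := by linarith
  exact le_of_mul_le_mul_left h9 t.2.1

/-- Changing both base point and parameter moves each atom by at most `(1-t) d(u,v) + |t-s| Δ`;
absorbing the first term costs a division by `t`. -/
lemma IsGlobalNPC.edist_flow_flow_le_abs (hM : IsGlobalNPC M) {p : ℝ} (hp : 1 ≤ p)
    (t s : Ioc (0 : ℝ) 1) (β : ContractiveBary p M) :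
    edist (hM.flow hp t β) (hM.flow hp s β) ≤ ENNReal.ofReal (|(t : ℝ) - s| / t) := by
  have hp0 : 0 < p := by linarith
  have ht := Ioc_subset_Icc_self t.2
  have hs := Ioc_subset_Icc_self s.2
  have ht0 := t.2.1
  refine ContractiveBary.edist_le_ofReal _ _ (by positivity) fun n x hx _ => ?_
  have hv' := (hM.flow hp s β).dist_le_diam hp0 x hx
  set u := (hM.flow hp t β).1 ⟨uniformOn x, hx⟩ with hu
  set v := (hM.flow hp s β).1 ⟨uniformOn x, hx⟩ with hv
  have h1 := hM.flow_uniformOn hp t β x hx hu (uniformOn_isProbPMoment hp0.le _)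
  have h2 := hM.flow_uniformOn hp s β x hx hv (uniformOn_isProbPMoment hp0.le _)
  have h4 := β.dist_uniformOn_le hp0 (fun j => geodPoint u t (x j))
    (fun j => geodPoint v s (x j)) (uniformOn_isProbPMoment hp0.le _)
    (uniformOn_isProbPMoment hp0.le _)
  rw [← h1, ← h2] at h4
  set R := (1 - t) * dist u v + |(t : ℝ) - s| * Metric.diam (range x) with hR
  have h5 : finAvg (fun j => dist (geodPoint u t (x j)) (geodPoint v s (x j)) ^ p) ≤ R ^ p := by
    rw [← finAvg_const (n := n) (R ^ p)]
    refine finAvg_mono fun j => Real.rpow_le_rpow dist_nonneg ?_ hp0.le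
    refine (dist_triangle _ (geodPoint v t (x j)) _).trans ?_
    have h6 := hM.dist_geodPoint_le u v (x j) (x j) ht
    rw [dist_self, mul_zero, add_zero] at h6
    rw [hM.dist_geodPoint_geodPoint v (x j) ht hs]
    exact add_le_add h6 (mul_le_mul_of_nonneg_left (hv' j) (abs_nonneg _))
  have hR0 : 0 ≤ R := add_nonneg (mul_nonneg (by linarith [ht.2]) dist_nonneg)
    (mul_nonneg (abs_nonneg _) Metric.diam_nonneg)
  have h6 := (Real.rpow_le_rpow_iff dist_nonneg hR0 hp0).1 (h4.trans h5)
  rw [div_mul_eq_mul_div, le_div_iff₀ ht0]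
  linarith

lemma IsGlobalNPC.continuous_flow (hM : IsGlobalNPC M) {p : ℝ} (hp : 1 ≤ p) :
    Continuous fun a : Ioc (0 : ℝ) 1 × ContractiveBary p M => hM.flow hp a.1 a.2 := by
  rw [continuous_iff_continuousAt]
  rintro ⟨t, β⟩
  rw [ContinuousAt, tendsto_iff_edist_tendsto_0]
  have hb : ∀ a : Ioc (0 : ℝ) 1 × ContractiveBary p M,
      edist (hM.flow hp a.1 a.2) (hM.flow hp t β) ≤
        edist a.2 β + ENNReal.ofReal (|(t : ℝ) - a.1| / t) := fun a => by
    refine (edist_triangle _ (hM.flow hp a.1 β) _).trans ?_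
    refine add_le_add (hM.edist_flow_le hp a.1 a.2 β) ?_
    rw [edist_comm]
    exact hM.edist_flow_flow_le_abs hp t a.1 β
  refine tendsto_of_tendsto_of_tendsto_of_le_of_le tendsto_const_nhds ?_ (fun _ => zero_le) hb
  have h1 : Tendsto (fun a : Ioc (0 : ℝ) 1 × ContractiveBary p M => edist a.2 β)
      (𝓝 (t, β)) (𝓝 0) := by
    rw [← edist_self β]
    exact (continuous_snd.edist continuous_const).tendsto (t, β)
  have h2 : Tendsto (fun a : Ioc (0 : ℝ) 1 × ContractiveBary p M =>
      ENNReal.ofReal (|(t : ℝ) - a.1| / t)) (𝓝 (t, β)) (𝓝 0) := by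
    have hc : Continuous fun a : Ioc (0 : ℝ) 1 × ContractiveBary p M =>
      ENNReal.ofReal (|(t : ℝ) - a.1| / t) := ENNReal.continuous_ofReal.comp (by fun_prop)
    have := hc.tendsto (t, β)
    simpa using this
  simpa using h1.add h2

end Flow

/-! ### The canonical barycentric map -/

section Canonical

variable {M : Type*} [MetricSpace M] [MeasurableSpace M] [BorelSpace M]

lemma ProbP.integrable_dist (μ : ProbP 1 M) (z : M) : Integrable (fun a => dist z a) μ.1 := by
  have hc : Continuous fun a => dist z a := by fun_prop
  refine ⟨hc.measurable.aestronglyMeasurable, ?_⟩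
  have := μ.2.lintegral_lt_top le_rfl z
  simpa [HasFiniteIntegral, edist_dist, Real.enorm_eq_ofReal] using this

/-- The difference of squares grows only linearly in `d(w,a)`, so a first moment suffices for
integrability. -/
lemma abs_dist_sq_sub_le (z w a : M) :
    |dist z a ^ 2 - dist w a ^ 2| ≤ dist z w * (2 * dist w a + dist z w) := by
  have h1 := dist_triangle z w a
  have h2 := dist_triangle_left w a z
  have h4 : |dist z a - dist w a| ≤ dist z w := by
    rw [abs_le]; constructor <;> linarith
  rw [sq_sub_sq, abs_mul, mul_comm]
  refine mul_le_mul h4 ?_ (abs_nonneg _) dist_nonneg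
  rw [abs_of_nonneg (by positivity)]
  linarith

lemma ProbP.integrable_dist_sq_sub (μ : ProbP 1 M) (z w : M) :
    Integrable (fun a => dist z a ^ 2 - dist w a ^ 2) μ.1 := by
  have := μ.2.isProb
  have hc : Continuous fun a => dist z a ^ 2 - dist w a ^ 2 := by fun_prop
  refine (((((μ.integrable_dist w).const_mul 2).add
    (integrable_const (dist z w))).const_mul (dist z w))).mono'
    hc.measurable.aestronglyMeasurable (.of_forall fun a => ?_)
  exact abs_dist_sq_sub_le z w a

/-- The relative variance `∫ [d(z,a)² - d(w,a)²] dμ(a)`. -/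
noncomputable def relVariance (μ : ProbP 1 M) (z w : M) : ℝ :=
  ∫ a, (dist z a ^ 2 - dist w a ^ 2) ∂μ.1

lemma relVariance_add (μ : ProbP 1 M) (z w y : M) :
    relVariance μ z w + relVariance μ w y = relVariance μ z y := by
  rw [relVariance, relVariance, ← integral_add (μ.integrable_dist_sq_sub z w)
    (μ.integrable_dist_sq_sub w y)]
  simp [relVariance]

lemma relVariance_le (μ : ProbP 1 M) (z w : M) :
    relVariance μ z w ≤ dist z w * (2 * (∫ a, dist w a ∂μ.1) + dist z w) := by
  have := μ.2.isProb
  have hi := ((μ.integrable_dist w).const_mul 2).add (integrable_const (dist z w))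
  calc relVariance μ z w ≤ ∫ a, dist z w * (2 * dist w a + dist z w) ∂μ.1 :=
        integral_mono (μ.integrable_dist_sq_sub z w) (hi.const_mul _)
          fun a => (le_abs_self _).trans (abs_dist_sq_sub_le z w a)
    _ = _ := by
        rw [integral_const_mul, integral_add ((μ.integrable_dist w).const_mul 2)
          (integrable_const _), integral_const_mul, integral_const]
        simp

lemma le_relVariance (μ : ProbP 1 M) (z w : M) :
    dist z w ^ 2 - 2 * dist z w * (∫ a, dist w a ∂μ.1) ≤ relVariance μ z w := by
  have := μ.2.isProb
  have hi := (integrable_const (dist z w ^ 2)).sub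
    ((μ.integrable_dist w).const_mul (2 * dist z w))
  calc _ = ∫ a, (dist z w ^ 2 - 2 * dist z w * dist w a) ∂μ.1 := by
        rw [integral_sub (integrable_const _) ((μ.integrable_dist w).const_mul _),
          integral_const_mul, integral_const]
        simp
    _ ≤ relVariance μ z w := by
        refine integral_mono hi (μ.integrable_dist_sq_sub z w) fun a => ?_
        have h1 := dist_triangle_right z w a
        have h2 := dist_triangle z w a
        have h3 := dist_triangle_left w a z
        have h4 : |dist z w - dist w a| ≤ dist z a := by
          rw [abs_le]; constructor <;> linarith
        have h5 := pow_le_pow_left₀ (abs_nonneg _) h4 2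
        rw [sq_abs] at h5
        change dist z w ^ 2 - 2 * dist z w * dist w a ≤ dist z a ^ 2 - dist w a ^ 2
        linarith

lemma IsGlobalNPC.relVariance_geodPoint_le (hM : IsGlobalNPC M) (μ : ProbP 1 M) (x y w : M)
    {t : ℝ} (ht : t ∈ Icc (0 : ℝ) 1) :
    relVariance μ (geodPoint x t y) w ≤ (1 - t) * relVariance μ x w + t * relVariance μ y w
      - t * (1 - t) * dist x y ^ 2 := by
  have := μ.2.isProb
  have i1 := (μ.integrable_dist_sq_sub x w).const_mul (1 - t)
  have i2 := (μ.integrable_dist_sq_sub y w).const_mul t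
  have i3 := integrable_const (μ := μ.1) (t * (1 - t) * dist x y ^ 2)
  calc relVariance μ (geodPoint x t y) w
      ≤ ∫ a, ((1 - t) * (dist x a ^ 2 - dist w a ^ 2) + t * (dist y a ^ 2 - dist w a ^ 2)
          - t * (1 - t) * dist x y ^ 2) ∂μ.1 := by
        refine integral_mono (μ.integrable_dist_sq_sub _ w) ((i1.add i2).sub i3) fun a => ?_
        have h := hM.isNPCPoint_geodPoint x y ht a
        rw [dist_comm a, dist_comm a x, dist_comm a y] at h
        change dist (geodPoint x t y) a ^ 2 - dist w a ^ 2 ≤ (1 - t) * (dist x a ^ 2 - dist w a ^ 2)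
          + t * (dist y a ^ 2 - dist w a ^ 2) - t * (1 - t) * dist x y ^ 2
        linarith
    _ = _ := by
        have e1 : ∫ a, ((1 - t) * (dist x a ^ 2 - dist w a ^ 2)
          + t * (dist y a ^ 2 - dist w a ^ 2) - t * (1 - t) * dist x y ^ 2) ∂μ.1
          = ∫ a, ((1 - t) * (dist x a ^ 2 - dist w a ^ 2)
          + t * (dist y a ^ 2 - dist w a ^ 2)) ∂μ.1 - ∫ _, t * (1 - t) * dist x y ^ 2 ∂μ.1 :=
          integral_sub (i1.add i2) i3
        rw [e1, integral_add i1 i2, integral_const_mul, integral_const_mul, integral_const]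
        simp [relVariance]

/-- Existence of the barycenter. -/
lemma IsGlobalNPC.exists_minimizer (hM : IsGlobalNPC M) (μ : ProbP 1 M) :
    ∃ b, ∀ z, 0 ≤ relVariance μ z b := by
  have := hM.complete
  obtain ⟨w, -⟩ := μ.2.moment
  set m := ∫ a, dist w a ∂μ.1
  set F : M → ℝ := fun z => relVariance μ z w with hF
  -- The lower bound completes the square in `d(z,w)² - 2 m d(z,w)`.
  have hbdd : BddBelow (range F) := by
    refine ⟨-m ^ 2, ?_⟩
    rintro _ ⟨z, rfl⟩
    have := le_relVariance μ z w
    simp only [hF]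
    nlinarith [sq_nonneg (dist z w - m)]
  set I := sInf (range F)
  have hI : ∀ z, I ≤ F z := fun z => csInf_le hbdd (mem_range_self z)
  have hseq : ∀ n : ℕ, ∃ z, F z < I + 1 / ((n : ℝ) + 1) := fun n => by
    obtain ⟨_, ⟨z, rfl⟩, hz⟩ := exists_lt_of_csInf_lt (⟨F w, mem_range_self w⟩ : (range F).Nonempty)
      (show I < I + 1 / ((n : ℝ) + 1) from lt_add_of_pos_right _ (by positivity))
    exact ⟨z, hz⟩
  choose z hz using hseq
  -- The midpoint of two almost minimizers cannot go below the infimum, so the term `d²/4` in strong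
  -- convexity is bounded by their excess.
  have hdist : ∀ n N : ℕ, N ≤ n → dist (z n) (z N) ^ 2 ≤ 4 * (1 / ((N : ℝ) + 1)) := by
    intro n N hn
    have h1 := hM.relVariance_geodPoint_le μ (z n) (z N) w (t := 1 / 2) (by norm_num)
    have h2 := hI (geodPoint (z n) (1 / 2) (z N))
    have h3 := hz n
    have h4 := hz N
    have h5 : 1 / ((n : ℝ) + 1) ≤ 1 / ((N : ℝ) + 1) := by gcongr
    simp only [hF] at h2 h3 h4
    linarith
  have hc : CauchySeq z := by
    rw [Metric.cauchySeq_iff']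
    intro ε hε
    obtain ⟨N, hN⟩ := exists_nat_one_div_lt (show 0 < ε ^ 2 / 4 by positivity)
    refine ⟨N, fun n hn => ?_⟩
    have := hdist n N hn
    exact lt_of_pow_lt_pow_left₀ 2 hε.le (by linarith)
  obtain ⟨b, hb⟩ := cauchySeq_tendsto_of_complete hc
  have hbI : F b ≤ I := by
    have hle : ∀ n : ℕ, F b ≤ I + 1 / ((n : ℝ) + 1)
        + dist b (z n) * (2 * (m + dist w (z n)) + dist b (z n)) := fun n => by
      have := μ.2.isProb
      have h1 := relVariance_add μ b (z n) w
      have h2 := relVariance_le μ b (z n)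
      have h3 : ∫ a, dist (z n) a ∂μ.1 ≤ m + dist w (z n) := by
        calc ∫ a, dist (z n) a ∂μ.1 ≤ ∫ a, (dist w a + dist w (z n)) ∂μ.1 :=
              integral_mono (μ.integrable_dist _) ((μ.integrable_dist w).add (integrable_const _))
                fun a => by
                  have := dist_triangle_left (z n) a w
                  simp only
                  linarith
          _ = _ := by
              rw [integral_add (μ.integrable_dist w) (integrable_const _), integral_const]
              simp [m]
      have h4 : dist b (z n) * (2 * (∫ a, dist (z n) a ∂μ.1) + dist b (z n)) ≤
          dist b (z n) * (2 * (m + dist w (z n)) + dist b (z n)) := by gcongr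
      have h5 := hz n
      simp only [hF] at h5 ⊢
      linarith
    have hlim : Tendsto (fun n : ℕ => I + 1 / ((n : ℝ) + 1)
        + dist b (z n) * (2 * (m + dist w (z n)) + dist b (z n))) atTop
        (𝓝 (I + 0 + dist b b * (2 * (m + dist w b) + dist b b))) := by
      have hd := (tendsto_const_nhds (x := b)).dist hb
      have hd' := (tendsto_const_nhds (x := w)).dist hb
      exact (tendsto_const_nhds.add tendsto_one_div_add_atTop_nhds_zero_nat).add
        (hd.mul (((tendsto_const_nhds.add hd').const_mul 2).add hd))
    have := ge_of_tendsto' hlim hle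
    simpa using this
  refine ⟨b, fun y => ?_⟩
  have h1 := relVariance_add μ y b w
  have h2 := hI y
  simp only [hF] at h2 hbI
  linarith

/-- Existence of the barycenter, with the variance inequality. -/
lemma IsGlobalNPC.exists_barycenter (hM : IsGlobalNPC M) (μ : ProbP 1 M) :
    ∃ b, ∀ z, dist z b ^ 2 ≤ relVariance μ z b := by
  obtain ⟨b, hb⟩ := hM.exists_minimizer μ
  refine ⟨b, fun z => ?_⟩
  have hbb : relVariance μ b b = 0 := by simp [relVariance]
  by_contra! h
  have h0 := hb z
  set G := relVariance μ z b
  set D := dist z b ^ 2 with hD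
  have hDpos : 0 < D := by linarith
  -- Minimality along the geodesic from `b` to `z` gives `G ≥ (1-t) D`. At this parameter `(1-t) D =
  -- (D+G)/2`, which exceeds `G` if `G < D`.
  have ht : (D - G) / (2 * D) ∈ Icc (0 : ℝ) 1 :=
    ⟨div_nonneg (by linarith) (by linarith), (div_le_one (by linarith)).2 (by linarith)⟩
  have ht0 : 0 < (D - G) / (2 * D) := div_pos (by linarith) (by linarith)
  have h1 := hM.relVariance_geodPoint_le μ b z b ht
  have h2 := hb (geodPoint b ((D - G) / (2 * D)) z)
  rw [hbb, dist_comm b z, ← hD] at h1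
  set t := (D - G) / (2 * D) with htdef
  have htD : t * D = (D - G) / 2 := by rw [htdef]; field_simp
  have h3 : 0 ≤ t * (G - (1 - t) * D) := by linarith
  have h4 := (mul_nonneg_iff_of_pos_left ht0).1 h3
  linarith

/-- The canonical barycentric map on `𝒫^1(M)`. -/
noncomputable def IsGlobalNPC.canonicalBary (hM : IsGlobalNPC M) : ContractiveBary 1 M :=
  ⟨fun μ => (hM.exists_barycenter μ).choose, by
    constructor
    · intro x μ hμ
      have h := (hM.exists_barycenter μ).choose_spec x
      set b := (hM.exists_barycenter μ).choose
      have hc : StronglyMeasurable fun a => dist x a ^ 2 - dist b a ^ 2 :=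
        (show Continuous fun a => dist x a ^ 2 - dist b a ^ 2 by
          fun_prop).measurable.stronglyMeasurable
      rw [relVariance, hμ, integral_dirac' _ _ hc, dist_self, dist_comm b x] at h
      have h2 : dist x b ^ 2 ≤ 0 := by nlinarith [sq_nonneg (dist x b)]
      exact (dist_eq_zero.1 (pow_eq_zero_iff two_ne_zero |>.1
        (le_antisymm h2 (sq_nonneg _)))).symm
    · intro μ ν
      refine le_wassersteinDist one_pos fun X _ _ _ π _ f g _ hf hg hμ hν => ?_
      have hb := (hM.exists_barycenter μ).choose_spec
      have hb' := (hM.exists_barycenter ν).choose_spec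
      set b := (hM.exists_barycenter μ).choose
      set b' := (hM.exists_barycenter ν).choose
      simp only [ENNReal.rpow_one]
      rcases eq_or_ne (∫⁻ x, edist (f x) (g x) ∂π) ∞ with htop | htop
      · rw [htop]; exact le_top
      have hcd : Continuous fun x => dist (f x) (g x) := hf.dist hg
      have hint : Integrable (fun x => dist (f x) (g x)) π := by
        refine ⟨hcd.measurable.aestronglyMeasurable, ?_⟩
        simpa [HasFiniteIntegral, edist_dist, Real.enorm_eq_ofReal, lt_top_iff_ne_top] using htop
      have hm : ∀ z w : M, Measurable fun a => dist z a ^ 2 - dist w a ^ 2 := fun z w =>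
        (show Continuous fun a => dist z a ^ 2 - dist w a ^ 2 by fun_prop).measurable
      have e1 : relVariance μ b' b = ∫ x, (dist b' (f x) ^ 2 - dist b (f x) ^ 2) ∂π := by
        rw [relVariance, ← hμ, integral_map hf.measurable.aemeasurable
          (hm _ _).aestronglyMeasurable]
      have e2 : relVariance ν b b' = ∫ x, (dist b (g x) ^ 2 - dist b' (g x) ^ 2) ∂π := by
        rw [relVariance, ← hν, integral_map hg.measurable.aemeasurable
          (hm _ _).aestronglyMeasurable]
      have i1 : Integrable (fun x => dist b' (f x) ^ 2 - dist b (f x) ^ 2) π := by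
        have := μ.integrable_dist_sq_sub b' b
        rw [← hμ] at this
        exact this.comp_measurable hf.measurable
      have i2 : Integrable (fun x => dist b (g x) ^ 2 - dist b' (g x) ^ 2) π := by
        have := ν.integrable_dist_sq_sub b b'
        rw [← hν] at this
        exact this.comp_measurable hg.measurable
      have h1 := hb b'
      have h2 := hb' b
      -- The two variance inequalities bound `2 d(b,b')²` by the left side, and the quadruple
      -- comparison is applied pointwise under the integral; one factor `2 d(b,b')` then cancels.
      have h3 : relVariance μ b' b + relVariance ν b b' ≤
          2 * dist b b' * ∫ x, dist (f x) (g x) ∂π := by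
        rw [e1, e2, ← integral_add i1 i2, ← integral_const_mul]
        refine integral_mono (i1.add i2) (hint.const_mul _) fun x => ?_
        have h := hM.quadruple b' b (f x) (g x)
        rw [dist_comm b' b] at h
        simp only
        linarith
      rw [dist_comm b' b] at h1
      have h4 : dist b b' ≤ ∫ x, dist (f x) (g x) ∂π := by
        rcases dist_nonneg (x := b) (y := b') |>.eq_or_lt with h0 | h0
        · rw [← h0]; exact integral_nonneg fun _ => dist_nonneg
        · refine le_of_mul_le_mul_left (a := 2 * dist b b') ?_ (by linarith)
          nlinarith
      rw [edist_dist]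
      refine (ENNReal.ofReal_le_ofReal h4).trans ?_
      rw [ofReal_integral_eq_lintegral_ofReal hint (.of_forall fun _ => dist_nonneg)]
      simp only [edist_dist]
      exact le_rfl⟩

lemma IsGlobalNPC.canonicalBary_variance (hM : IsGlobalNPC M) (μ : ProbP 1 M) (z : M) :
    dist z (hM.canonicalBary.1 μ) ^ 2 ≤ relVariance μ z (hM.canonicalBary.1 μ) :=
  (hM.exists_barycenter μ).choose_spec z

lemma IsGlobalNPC.isCanonical_canonicalBary (hM : IsGlobalNPC M) :
    IsCanonicalBarycentricMap hM.canonicalBary := by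
  intro μ y z hz
  have h1 := hM.canonicalBary_variance μ z
  have h2 := relVariance_add μ z (hM.canonicalBary.1 μ) y
  have h3 := dist_pos.2 hz
  change relVariance μ _ y < relVariance μ z y
  nlinarith

/-! ### Convergence of the flow to the canonical map -/

lemma integral_uniformOn {n : ℕ} (x : Fin (n + 1) → M) {f : M → ℝ} (hf : Continuous f) :
    ∫ a, f a ∂(uniformOn x) = finAvg fun j => f (x j) := by
  have hs : StronglyMeasurable f := hf.measurable.stronglyMeasurable
  rw [uniformOn, integral_smul_measure, integral_finsetSum_measure]
  · simp only [integral_dirac' _ _ hs, finAvg, smul_eq_mul]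
    rw [ENNReal.toReal_inv, ENNReal.toReal_natCast, div_eq_inv_mul]
    push_cast
    rfl
  · intro j _
    exact integrable_dirac' hs (by finiteness)

/-- The flow's variance inequality is tested at `b` and the canonical one at `u`. Their sum bounds
`2 d(u,b)²` by `t` times the mean of `d(u,x_j)²`, since `k_2 = 2`; the spare factor `1/2` is
dropped. -/
lemma IsGlobalNPC.edist_flow_canonicalBary_le (hM : IsGlobalNPC M) (hp : (1 : ℝ) ≤ 1)
    (t : Ioc (0 : ℝ) 1) (β : ContractiveBary 1 M) :
    edist (hM.flow hp t β) hM.canonicalBary ≤ ENNReal.ofReal √(t : ℝ) := by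
  have ht0 := t.2.1
  refine ContractiveBary.edist_le_ofReal _ _ (Real.sqrt_nonneg _) fun n x hx _ => ?_
  set u := (hM.flow hp t β).1 ⟨uniformOn x, hx⟩ with hu
  set b := hM.canonicalBary.1 ⟨uniformOn x, hx⟩ with hb
  have h1 := hM.variance_flow hp t β x hx b
  have h2 := hM.canonicalBary_variance ⟨uniformOn x, hx⟩ u
  have h3 := finAvg_dist_rpow_le_diam one_pos zero_le_two (hM.flow hp t β) x hx
  rw [← hu] at h1 h3
  change dist u b ^ 2 ≤ ∫ a, (dist u a ^ 2 - dist b a ^ 2) ∂(uniformOn x) at h2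
  rw [integral_uniformOn x (by fun_prop)] at h2
  have h4 := finAvg_combo 0 1 1 (fun j => dist u (x j) ^ 2) (fun j => dist b (x j) ^ 2)
  simp only [zero_add, one_mul] at h4
  rw [h4] at h2
  simp only [mul_one, Real.rpow_two, convexityConst_two] at h1 h3
  rw [dist_comm b u] at h1
  have hΔ : 0 ≤ Metric.diam (range x) := Metric.diam_nonneg
  have h5 : dist u b ^ 2 ≤ (√(t : ℝ) * Metric.diam (range x)) ^ 2 := by
    rw [mul_pow, Real.sq_sqrt ht0.le]
    have := mul_le_mul_of_nonneg_left h3 ht0.le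
    nlinarith [sq_nonneg (dist u b)]
  exact (abs_le_of_sq_le_sq' h5 (by positivity)).2

lemma IsGlobalNPC.tendsto_flow (hM : IsGlobalNPC M) (hp : (1 : ℝ) ≤ 1)
    (β : ContractiveBary 1 M) : Tendsto (fun t => hM.flow hp t β)
      (comap ((↑) : Ioc (0 : ℝ) 1 → ℝ) (𝓝[>] 0)) (𝓝 hM.canonicalBary) := by
  rw [tendsto_iff_edist_tendsto_0]
  refine tendsto_of_tendsto_of_tendsto_of_le_of_le tendsto_const_nhds ?_ (fun _ => zero_le)
    fun t => hM.edist_flow_canonicalBary_le hp t β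
  have h1 : Tendsto (fun t : ℝ => ENNReal.ofReal √t) (𝓝[>] 0) (𝓝 0) := by
    have hc : Continuous fun t : ℝ => ENNReal.ofReal √t :=
      ENNReal.continuous_ofReal.comp Real.continuous_sqrt
    have := (hc.tendsto 0).mono_left (nhdsWithin_le_nhds (s := Ioi 0))
    simpa using this
  exact h1.comp tendsto_comap

end Canonical

theorem theorem5p5 {M : Type*} [MetricSpace M] [MeasurableSpace M] [BorelSpace M]
    (hM : IsGlobalNPC M) (p : ℝ) (hp : 1 ≤ p) :
    ∃ hmem : ∀ (x : M), ∀ t ∈ Set.Icc (0 : ℝ) 1, ∀ μ : ProbP p M,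
        IsProbPMoment p (geodMeasure x t μ.1),
    ∃ Φ : Set.Ioc (0 : ℝ) 1 → ContractiveBary p M → ContractiveBary p M,
      -- `Φ` is a continuous semiflow of the multiplicative semigroup `(0,1]`
      Continuous (fun a : Set.Ioc (0 : ℝ) 1 × ContractiveBary p M => Φ a.1 a.2) ∧
      (∀ β, Φ 1 β = β) ∧
      (∀ s t β, Φ t (Φ s β) = Φ (t * s) β) ∧
      -- the characterization
      (∀ (t : Set.Ioc (0 : ℝ) 1) (β : ContractiveBary p M) (μ : ProbP p M) (x : M),
        x = (Φ t β).1 μ ↔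
          x = β.1 ⟨geodMeasure x t μ.1, hmem x t (Set.Ioc_subset_Icc_self t.2) μ⟩) ∧
      -- the estimate
      (∀ (t s : Set.Ioc (0 : ℝ) 1) (β : ContractiveBary p M),
        edist (Φ t β) (Φ s β) ≤ ENNReal.ofReal
          (((convexityConst (2 * p) * ((s : ℝ) + t) + 2 * (2 - convexityConst (2 * p))) / 4)
            ^ (1 / (2 * p)))) ∧
      -- the limit for `p = 1`
      (p = 1 → ∃ bar : ContractiveBary p M, IsCanonicalBarycentricMap bar ∧
        ∀ β, Tendsto (fun t => Φ t β)
          (comap ((↑) : Set.Ioc (0 : ℝ) 1 → ℝ) (𝓝[>] 0)) (𝓝 bar)) := by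
  refine ⟨fun x t ht μ => hM.isProbPMoment_geodMeasure hp x ht μ, hM.flow hp,
    hM.continuous_flow hp, hM.flow_one hp, hM.flow_flow hp, hM.flow_spec hp,
    hM.edist_flow_flow_le hp, ?_⟩
  rintro rfl
  exact ⟨hM.canonicalBary, hM.isCanonical_canonicalBary, hM.tendsto_flow hp⟩
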